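/- Let $m\ge 2$ be an integer and let $\mathcal A=\{0,1,\dots,m-1\}$. Equip $\mathcal A^{\mathbb N}=\{\omega_1\omega_2\cdots:\omega_i\in\mathcal A\}$ with the metric $d(u,\omega)=m^{-\min\{i\ge 1:\,u_i\ne\omega_i\}}$ for $u\neq\omega$, $d(\omega,\omega)=0$, and with the shift map $(\sigma\omega)_i=\omega_{i+1}$. Let $\Sigma\subset\mathcal A^{\mathbb N}$ be a subshift, that is, a closed set with $\sigma(\Sigma)\subset\Sigma$. For $n\geq 0$ let $\Sigma^n$ be the set of words $\omega_1\cdots\omega_n$ that are the first $n$ letters of some element of $\Sigma$, and let $\Sigma^*=\bigcup_{n\ge1}\Sigma^n$. Suppose that - $\Sigma$ has specification: there is an integer $M\ge 0$ such that for all $u,v\in\Sigma^*$ there is $w\in\Sigma^M$ with $uwv\in\Sigma^*$; - the topological entropy $h(\Sigma)=\lim_{n\to\infty}\frac1n\log\#\Sigma^n$ is positive; - $0^\infty=000\cdots\in\Sigma$. For $\omega\in\Sigma$ and $n,N\ge1$ put $l_n(\omega)=\sup\{k\ge 0:\ \omega_{n+i}=0\text{ for all }1\le i\le k\}\in\{0,1,2,\dots\}\cup\{\infty\}$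 and $L_N(\omega)=\max_{1\le n\le N}l_n(\omega)$, and for real $a\ge0$ let $$\mathcal U_{\psi_0}(a)=\Big\{\omega\in\Sigma:\ \liminf_{N\to\infty}\frac{L_N(\omega)}{N}\ge a\Big\}.$$ Let $\dim_{\mathrm H}$ denote the Hausdorff dimension with respect to $d$. Then: (i) If $a>1$, then $\mathcal U_{\psi_0}(a)=\bigcup_{n=0}^{\infty}\{\omega\in\Sigma:\ \sigma^n\omega=0^\infty\}$. (ii) If $0\le a\le 1$, then $$\dim_{\mathrm H}\mathcal U_{\psi_0}(a)=\Big(\frac{1-a}{1+a}\Big)^2\dim_{\mathrm H}\Sigma .$$ -/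

import Mathlib

open Filter Topology
open scoped ENNReal

/-- The symbolic space of infinite words over the alphabet `{0, …, m-1}`. Coordinates are indexed
from `0`: the value `x i` is the letter usually written `x_{i+1}`. -/
def SymbolicSpace (m : ℕ) : Type := ℕ → Fin m

namespace SymbolicSpace

variable {m : ℕ}

/-- The metric `d(x, y) = m ^ (-min {i ≥ 1 : x_i ≠ y_i})` for `x ≠ y`, and `d(x, x) = 0`. Since
`PiNat.firstDiff` counts coordinates from `0`, the minimum is `firstDiff x y + 1`. -/
noncomputable instance instMetricSpace : MetricSpace (SymbolicSpace m) where
  dist x y := open Classical in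
    if x = y then 0 else ((m : ℝ)⁻¹) ^ (PiNat.firstDiff (E := fun _ => Fin m) x y + 1)
  dist_self x := by simp
  dist_comm x y := by
    by_cases h : x = y
    · subst h; rfl
    · simp only [h, Ne.symm h, if_false, PiNat.firstDiff_comm (E := fun _ => Fin m) x y]
  dist_triangle x y z := by
    have hm : (1 : ℝ) ≤ m := by
      have : 0 < m := (Nat.zero_le _).trans_lt (x 0).isLt
      exact_mod_cast this
    have h0 : (0 : ℝ) ≤ (m : ℝ)⁻¹ := by positivity
    have h1 : (m : ℝ)⁻¹ ≤ 1 := inv_le_one_of_one_le₀ hm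
    have hp : ∀ k : ℕ, (0 : ℝ) ≤ ((m : ℝ)⁻¹) ^ k := fun k => pow_nonneg h0 k
    by_cases hxz : x = z
    · simp only [hxz, if_true]
      split_ifs <;> simp [add_nonneg]
    by_cases hxy : x = y
    · subst hxy; simp
    by_cases hyz : y = z
    · subst hyz; simp
    simp only [hxz, hxy, hyz, if_false]
    have h := PiNat.min_firstDiff_le (E := fun _ => Fin m) x y z hxz
    rcases min_le_iff.mp h with h | h
    · exact (pow_le_pow_of_le_one h0 h1 (Nat.succ_le_succ h)).trans (le_add_of_nonneg_right (hp _))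
    · exact (pow_le_pow_of_le_one h0 h1 (Nat.succ_le_succ h)).trans (le_add_of_nonneg_left (hp _))
  eq_of_dist_eq_zero {x y} h := by
    by_contra hne
    have hm : 0 < m := (Nat.zero_le _).trans_lt (x 0).isLt
    simp only [hne, if_false] at h
    have : (0 : ℝ) < (m : ℝ)⁻¹ := by positivity
    exact (pow_pos this _).ne' h

/-- The shift map `(σ x)_i = x_{i+1}`. -/
def shift (x : SymbolicSpace m) : SymbolicSpace m := fun i => x (i + 1)

/-- The word `0^∞`. -/
def zeros (m : ℕ) [NeZero m] : SymbolicSpace m := fun _ => 0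

/-- The finite word formed by the first `n` letters of `x`. -/
def firstLetters (x : SymbolicSpace m) (n : ℕ) : List (Fin m) := (List.range n).map fun i => x i

/-- `l_n(x) = sup {k ≥ 0 : x_{n+i} = 0 for all 1 ≤ i ≤ k}`, possibly infinite. -/
noncomputable def zeroRun [NeZero m] (x : SymbolicSpace m) (n : ℕ) : ℕ∞ :=
  ⨆ (k : ℕ) (_ : ∀ j < k, x (n + j) = 0), (k : ℕ∞)

/-- `L_N(x) = max_{1 ≤ n ≤ N} l_n(x)`, possibly infinite. -/
noncomputable def maxZeroRun [NeZero m] (x : SymbolicSpace m) (N : ℕ) : ℕ∞ :=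
  ⨆ n ∈ Finset.Icc 1 N, x.zeroRun n

lemma shift_iterate_apply (x : SymbolicSpace m) (n i : ℕ) : (shift^[n] x) i = x (n + i) := by
  induction n generalizing x with
  | zero => simp
  | succ n ih => rw [Function.iterate_succ_apply, ih]; exact congrArg x (by omega)

lemma firstLetters_add (x : SymbolicSpace m) (i j : ℕ) :
    x.firstLetters (i + j) = x.firstLetters i ++ (shift^[i] x).firstLetters j := by
  simp only [firstLetters, List.range_add, List.map_append, List.map_map]
  congr 1
  exact List.map_congr_left fun k _ => (shift_iterate_apply x i k).symm

end SymbolicSpace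

/-- A subshift: a closed subset `Σ` of the symbolic space with `σ(Σ) ⊆ Σ`. -/
structure Subshift (m : ℕ) where
  carrier : Set (SymbolicSpace m)
  isClosed : IsClosed carrier
  shift_mem : ∀ x ∈ carrier, x.shift ∈ carrier

namespace Subshift

variable {m : ℕ}

/-- The set `Σ^n` of words of length `n` that are prefixes of elements of `Σ`. -/
def words (S : Subshift m) (n : ℕ) : Set (List (Fin m)) :=
  (fun x : SymbolicSpace m => x.firstLetters n) '' S.carrier

/-- The language `Σ^* = ⋃_{n ≥ 1} Σ^n`. -/
def language (S : Subshift m) : Set (List (Fin m)) := {w | ∃ n, 1 ≤ n ∧ w ∈ S.words n}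

/-- Specification: there is `M` such that any two words `u, v ∈ Σ^*` can be joined by some
`w ∈ Σ^M`, that is, `u w v ∈ Σ^*`. -/
def HasSpecification (S : Subshift m) : Prop :=
  ∃ M : ℕ, ∀ u ∈ S.language, ∀ v ∈ S.language, ∃ w ∈ S.words M, u ++ w ++ v ∈ S.language

lemma shift_iterate_mem (S : Subshift m) (n : ℕ) {x : SymbolicSpace m} (hx : x ∈ S.carrier) :
    SymbolicSpace.shift^[n] x ∈ S.carrier := by
  induction n generalizing x with
  | zero => exact hx
  | succ n ih => exact ih (S.shift_mem x hx)

lemma words_finite (S : Subshift m) (n : ℕ) : (S.words n).Finite := by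
  refine (List.finite_length_eq (Fin m) n).subset ?_
  rintro _ ⟨x, -, rfl⟩
  simp [SymbolicSpace.firstLetters]

lemma ncard_words_add_le (S : Subshift m) (i j : ℕ) :
    (S.words (i + j)).ncard ≤ (S.words i).ncard * (S.words j).ncard := by
  have hfin := (S.words_finite i).prod (S.words_finite j)
  rw [← Set.ncard_prod]
  refine le_trans (Set.ncard_le_ncard ?_ (hfin.image fun p => p.1 ++ p.2))
    (Set.ncard_image_le hfin)
  rintro _ ⟨x, hx, rfl⟩
  exact ⟨(x.firstLetters i, (SymbolicSpace.shift^[i] x).firstLetters j),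
    ⟨⟨x, hx, rfl⟩, ⟨_, S.shift_iterate_mem i hx, rfl⟩⟩, (x.firstLetters_add i j).symm⟩

lemma subadditive_log_ncard_words (S : Subshift m) :
    Subadditive fun n => Real.log ((S.words n).ncard : ℝ) := by
  intro i j
  have h := S.ncard_words_add_le i j
  rcases Nat.eq_zero_or_pos (S.words (i + j)).ncard with h0 | h0
  · simp only [h0, Nat.cast_zero, Real.log_zero]
    exact add_nonneg (Real.log_natCast_nonneg _) (Real.log_natCast_nonneg _)
  · have hp := h0.trans_le h
    have hi : (S.words i).ncard ≠ 0 := (Nat.pos_of_mul_pos_right hp).ne'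
    have hj : (S.words j).ncard ≠ 0 := (Nat.pos_of_mul_pos_left hp).ne'
    rw [← Real.log_mul (by exact_mod_cast hi) (by exact_mod_cast hj)]
    exact Real.log_le_log (by exact_mod_cast h0) (by exact_mod_cast h)

/-- The topological entropy `h(Σ) = lim_n log #Σ^n / n = inf_{n ≥ 1} log #Σ^n / n`. -/
noncomputable def entropy (S : Subshift m) : ℝ := S.subadditive_log_ncard_words.lim

/-- The defining limit of the entropy exists and equals `entropy`. -/
lemma tendsto_entropy (S : Subshift m) :
    Tendsto (fun n : ℕ => Real.log ((S.words n).ncard : ℝ) / n) atTop (𝓝 S.entropy) := by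
  refine S.subadditive_log_ncard_words.tendsto_lim ⟨0, ?_⟩
  rintro _ ⟨n, rfl⟩
  exact div_nonneg (Real.log_natCast_nonneg _) (Nat.cast_nonneg _)

/-- The set of `x ∈ Σ` with `liminf_N L_N(x) / N ≥ a`, the lower limit being taken in `[0, ∞]`. -/
noncomputable def liminfZeroRunSet [NeZero m] (S : Subshift m) (a : ℝ) : Set (SymbolicSpace m) :=
  {x ∈ S.carrier |
    ENNReal.ofReal a ≤ liminf (fun N : ℕ => (x.maxZeroRun N : ℝ≥0∞) / (N : ℝ≥0∞)) atTop}

end Subshift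

/-! With `h` the entropy, `dim Σ = h / log m`. A prefix of length `E` with only `F` letters outside
its chosen zero blocks allows about `exp (h F)` words, each giving a cylinder of diameter about `m ^
(-E)`. So the dimension is `dim Σ` times the best possible value of `liminf F / E`, and the factor
`((1 - a) / (1 + a)) ^ 2` solves an extremal problem on the layout of zero blocks.

Upper bound: the eventually zero points are countable. Any other point has record zero runs `[n k, n
k + L k)` with `b * n (k + 1) ≤ L k`, for each `b < a` (`exists_record_blocks`). By
`exists_uncovered_le`, `F / E` then drops infinitely often to any level above `((1 - b) / (1 + b)) ^
2`. Since `n k` grows geometrically, a prefix contains few runs and recording their lengths costs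
little, so a Borel–Cantelli covering by coded cylinders applies.

Lower bound: `exists_sparse_layout` spaces long zero blocks at the extremal geometric rate.
Specification allows arbitrary words of length `q` between them, and reading these words as digits
maps the points onto `[0, 1]` by a Hölder map (`le_dimH_zeroBlockSet`).

For `a > 1` the runs are so long that they contain every late coordinate. -/

namespace SymbolicSpace

variable {m : ℕ}

/-! ### Cylinders, eventually zero points and zero runs. -/

lemma pos_of_nonempty (x : SymbolicSpace m) : 0 < m := (Nat.zero_le _).trans_lt (x 0).isLt

lemma dist_le_of_agree {x y : SymbolicSpace m} {N : ℕ} (h : ∀ i < N, x i = y i) :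
    dist x y ≤ ((m : ℝ)⁻¹) ^ (N + 1) := by
  have hm : (1 : ℝ) ≤ m := by exact_mod_cast pos_of_nonempty x
  by_cases hxy : x = y
  · subst hxy; rw [dist_self]; positivity
  · have : dist x y = ((m : ℝ)⁻¹) ^ (PiNat.firstDiff (E := fun _ => Fin m) x y + 1) := by
      simp [dist, hxy]
    rw [this]
    refine pow_le_pow_of_le_one (by positivity) (inv_le_one_of_one_le₀ hm) (Nat.succ_le_succ ?_)
    by_contra! hlt
    exact PiNat.apply_firstDiff_ne (E := fun _ => Fin m) hxy (h _ hlt)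

lemma exists_agree_of_ne {x y : SymbolicSpace m} (hxy : x ≠ y) :
    ∃ N, (∀ i < N, x i = y i) ∧ dist x y = ((m : ℝ)⁻¹) ^ (N + 1) := by
  refine ⟨PiNat.firstDiff (E := fun _ => Fin m) x y, fun i hi => ?_, by simp [dist, hxy]⟩
  exact PiNat.apply_eq_of_lt_firstDiff (E := fun _ => Fin m) hi

lemma ediam_le_of_agree {t : Set (SymbolicSpace m)} {N : ℕ}
    (h : ∀ x ∈ t, ∀ y ∈ t, ∀ i < N, x i = y i) :
    Metric.ediam t ≤ ENNReal.ofReal (((m : ℝ)⁻¹) ^ N) := by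
  refine Metric.ediam_le fun x hx y hy => ?_
  rw [edist_dist]
  refine ENNReal.ofReal_le_ofReal ((dist_le_of_agree (h x hx y hy)).trans ?_)
  have hm : (1 : ℝ) ≤ m := by exact_mod_cast pos_of_nonempty x
  exact pow_le_pow_of_le_one (by positivity) (inv_le_one_of_one_le₀ hm) (Nat.le_succ N)

lemma ediam_rpow_le_of_agree {t : Set (SymbolicSpace m)} {N : ℕ} (hm : 0 < m) {s : ℝ} (hs : 0 ≤ s)
    (h : ∀ x ∈ t, ∀ y ∈ t, ∀ i < N, x i = y i) :
    Metric.ediam t ^ s ≤ ENNReal.ofReal (Real.exp (-(s * Real.log m * N))) := by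
  have hm' : (0 : ℝ) < m := by exact_mod_cast hm
  refine (ENNReal.rpow_le_rpow (ediam_le_of_agree h) hs).trans_eq ?_
  rw [ENNReal.ofReal_rpow_of_pos (by positivity), ← Real.rpow_natCast, ← Real.rpow_mul (by positivity),
    Real.rpow_def_of_pos (by positivity), Real.log_inv]
  congr 2; ring

@[simp] lemma length_firstLetters (x : SymbolicSpace m) (n : ℕ) :
    (x.firstLetters n).length = n := by simp [firstLetters]

lemma getElem_firstLetters (x : SymbolicSpace m) (n i : ℕ) (h : i < (x.firstLetters n).length) :
    (x.firstLetters n)[i] = x i := by simp [firstLetters]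

lemma firstLetters_eq_iff {x y : SymbolicSpace m} {n : ℕ} :
    x.firstLetters n = y.firstLetters n ↔ ∀ i < n, x i = y i := by
  simp [firstLetters, List.map_inj_left]

lemma shift_iterate_eq_zeros_iff [NeZero m] {x : SymbolicSpace m} {n : ℕ} :
    shift^[n] x = zeros m ↔ ∀ i, n ≤ i → x i = 0 := by
  constructor
  · intro h i hi
    have := congrFun h (i - n)
    rwa [shift_iterate_apply, Nat.add_sub_cancel' hi] at this
  · intro h
    funext i
    rw [shift_iterate_apply]
    exact h _ (Nat.le_add_right n i)

lemma countable_eventually_zero [NeZero m] (n : ℕ) :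
    {x : SymbolicSpace m | shift^[n] x = zeros m}.Countable := by
  refine Set.MapsTo.countable_of_injOn (f := fun x : SymbolicSpace m => x.firstLetters n)
    (Set.mapsTo_univ _ _) (fun x hx y hy hxy => ?_) (Set.to_countable (Set.univ : Set (List (Fin m))))
  rw [Set.mem_ofPred_eq, shift_iterate_eq_zeros_iff] at hx hy
  funext i
  rcases lt_or_ge i n with hi | hi
  · exact firstLetters_eq_iff.1 hxy i hi
  · rw [hx i hi, hy i hi]

lemma le_maxZeroRun [NeZero m] {x : SymbolicSpace m} {N n k : ℕ} (h1 : 1 ≤ n) (h2 : n ≤ N)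
    (h : ∀ j < k, x (n + j) = 0) : (k : ℕ∞) ≤ x.maxZeroRun N := by
  refine le_trans ?_ (le_iSup₂_of_le n (Finset.mem_Icc.2 ⟨h1, h2⟩) le_rfl)
  exact le_iSup₂_of_le (f := fun (k : ℕ) (_ : ∀ j < k, x (n + j) = 0) => (k : ℕ∞)) k h le_rfl

lemma exists_of_lt_maxZeroRun [NeZero m] {x : SymbolicSpace m} {N : ℕ} {r : ℕ∞}
    (h : r < x.maxZeroRun N) :
    ∃ n k : ℕ, 1 ≤ n ∧ n ≤ N ∧ r < k ∧ ∀ j < k, x (n + j) = 0 := by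
  simp only [maxZeroRun, zeroRun, lt_iSup_iff, Finset.mem_Icc] at h
  obtain ⟨n, ⟨h1, h2⟩, k, hk, hr⟩ := h
  exact ⟨n, k, h1, h2, hr, hk⟩

/-- A lower bound on the lower limit of `L_N / N` produces long zero blocks starting before `N`. -/
lemma exists_zero_block_of_lt_liminf [NeZero m] {x : SymbolicSpace m} {b : ℝ} (hb : 0 ≤ b)
    (h : ENNReal.ofReal b < liminf (fun N : ℕ => (x.maxZeroRun N : ℝ≥0∞) / (N : ℝ≥0∞)) atTop) :
    ∀ᶠ N : ℕ in atTop, ∃ n k : ℕ, 1 ≤ n ∧ n ≤ N ∧ b * N ≤ k ∧ ∀ j < k, x (n + j) = 0 := by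
  filter_upwards [eventually_lt_of_lt_liminf h, eventually_gt_atTop 0] with N hN hN0
  have h0 : (N : ℝ≥0∞) ≠ 0 := by exact_mod_cast hN0.ne'
  rw [ENNReal.lt_div_iff_mul_lt (Or.inl h0) (Or.inl (ENNReal.natCast_ne_top N))] at hN
  by_cases hk : ∃ n k : ℕ, 1 ≤ n ∧ n ≤ N ∧ b * N ≤ k ∧ ∀ j < k, x (n + j) = 0
  · exact hk
  exfalso
  refine absurd hN (not_lt.2 ?_)
  have : x.maxZeroRun N ≤ (⌊b * N⌋₊ : ℕ∞) := by
    by_contra! hlt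
    obtain ⟨n, k, h1, h2, hr, hz⟩ := exists_of_lt_maxZeroRun hlt
    refine hk ⟨n, k, h1, h2, ?_, hz⟩
    have : ⌊b * N⌋₊ < k := by exact_mod_cast hr
    exact (Nat.lt_of_floor_lt this).le
  calc (x.maxZeroRun N : ℝ≥0∞) ≤ ((⌊b * N⌋₊ : ℕ∞) : ℝ≥0∞) := by exact_mod_cast this
    _ = ENNReal.ofReal (⌊b * N⌋₊ : ℝ) := by simp
    _ ≤ ENNReal.ofReal (b * N) := ENNReal.ofReal_le_ofReal (Nat.floor_le (by positivity))
    _ = ENNReal.ofReal b * N := by rw [ENNReal.ofReal_mul hb]; simp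

end SymbolicSpace

/-! ### The case `a > 1`. -/

namespace Subshift
open SymbolicSpace
variable {m : ℕ}

lemma liminfZeroRunSet_of_one_lt [NeZero m] (S : Subshift m) {a : ℝ} (ha : 1 < a) :
    S.liminfZeroRunSet a =
      ⋃ n : ℕ, {x ∈ S.carrier | SymbolicSpace.shift^[n] x = SymbolicSpace.zeros m} := by
  ext x
  simp only [liminfZeroRunSet, Set.mem_ofPred_eq, Set.mem_iUnion, exists_and_left,
    shift_iterate_eq_zeros_iff]
  refine and_congr_right fun _ => ⟨fun h => ?_, ?_⟩
  · by_contra! hne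
    have h1 : ENNReal.ofReal 1 < ENNReal.ofReal a :=
      (ENNReal.ofReal_lt_ofReal_iff (by linarith)).2 ha
    obtain ⟨N₀, hN₀⟩ := eventually_atTop.1 (exists_zero_block_of_lt_liminf zero_le_one (h1.trans_le h))
    obtain ⟨i, hi, hxi⟩ := hne (N₀ + 1)
    obtain ⟨n, k, hn, hnN, hk, hz⟩ := hN₀ i (by omega)
    rw [one_mul] at hk
    have hk' : i ≤ k := by exact_mod_cast hk
    -- A run starting at `n` with `1 ≤ n ≤ i` and of length at least `i` contains the coordinate
    -- `i`.
    refine hxi ?_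
    have := hz (i - n) (by omega)
    rwa [Nat.add_sub_cancel' hnN] at this
  · rintro ⟨n, hn⟩
    refine le_trans le_top (le_of_eq (Eq.symm ?_))
    refine Tendsto.liminf_eq (tendsto_const_nhds.congr' ?_)
    filter_upwards [eventually_ge_atTop (n + 1)] with N hN
    have : x.maxZeroRun N = ⊤ := by
      refine ENat.eq_top_iff_forall_ge.2 fun k => ?_
      exact le_maxZeroRun (n := N) (by omega) le_rfl fun j _ => hn _ (by omega)
    rw [this]
    simp [ENNReal.top_div]

end Subshift

/-! ### Covering bounds for Hausdorff dimension. -/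

/-- A Borel–Cantelli lemma for Hausdorff measures. -/
lemma hausdorffMeasure_eq_zero_of_infinite_cover {X ι : Type*} [EMetricSpace X] [MeasurableSpace X]
    [BorelSpace X] [Countable ι] {s : ℝ} (hs : 0 < s) {A : Set X} (t : ι → Set X)
    (hsum : ∑' i, Metric.ediam (t i) ^ s ≠ ∞) (hA : ∀ x ∈ A, {i | x ∈ t i}.Infinite) :
    MeasureTheory.Measure.hausdorffMeasure s A = 0 := by
  classical
  have h0 := ENNReal.tendsto_tsum_compl_atTop_zero hsum
  -- Discarding finitely many indices `F` still leaves a cover of `A`. Each remaining diameter is at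
  -- most the tail sum to the power `1 / s`, so the mesh tends to zero together with the tail.
  have key := MeasureTheory.Measure.hausdorffMeasure_le_liminf_tsum (β := Finset ι)
    (ι := fun F => {i // i ∉ F}) s A (l := atTop)
    (fun F => (∑' i : {i // i ∉ F}, Metric.ediam (t i) ^ s) ^ s⁻¹) ?_ (fun F i => t i) ?_ ?_
  · rw [h0.liminf_eq] at key
    exact le_antisymm key zero_le
  · have := h0.ennrpow_const s⁻¹
    rwa [ENNReal.zero_rpow_of_pos (inv_pos.2 hs)] at this
  · refine Eventually.of_forall fun F i => ?_
    rw [← ENNReal.rpow_le_rpow_iff hs, ENNReal.rpow_inv_rpow hs.ne']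
    exact ENNReal.le_tsum (f := fun i : {i // i ∉ F} => Metric.ediam (t i) ^ s) i
  · refine Eventually.of_forall fun F x hx => ?_
    obtain ⟨i, hi, hiF⟩ := (hA x hx).exists_notMem_finset F
    exact Set.mem_iUnion.2 ⟨⟨i, hiF⟩, hi⟩

lemma dimH_le_of_infinite_cover {X ι : Type*} [EMetricSpace X] [Countable ι] {s : ℝ} (hs : 0 < s)
    {A : Set X} (t : ι → Set X) (hsum : ∑' i, Metric.ediam (t i) ^ s ≠ ∞)
    (hA : ∀ x ∈ A, {i | x ∈ t i}.Infinite) : dimH A ≤ ENNReal.ofReal s := by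
  borelize X
  have h := hausdorffMeasure_eq_zero_of_infinite_cover hs t hsum hA
  rw [ENNReal.ofReal]
  refine dimH_le_of_hausdorffMeasure_ne_top ?_
  rw [Real.coe_toNNReal s hs.le, h]
  exact ENNReal.zero_ne_top

lemma ENNReal.tsum_fin_pi_prod {α : Type*} (g : α → ℝ≥0∞) (k : ℕ) :
    ∑' c : Fin k → α, ∏ i, g (c i) = (∑' a, g a) ^ k := by
  induction k with
  | zero => simp
  | succ k ih =>
    rw [← (Fin.consEquiv fun _ : Fin (k + 1) => α).tsum_eq, ENNReal.tsum_prod', pow_succ']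
    simp [Fin.consEquiv, Fin.prod_univ_succ, ENNReal.tsum_mul_left, ENNReal.tsum_mul_right, ih]

/-! ### Weights of words and the upper bound for the dimension of the subshift. -/

namespace Subshift
open SymbolicSpace
variable {m : ℕ}

lemma length_of_mem_words {S : Subshift m} {n : ℕ} {v : List (Fin m)} (hv : v ∈ S.words n) :
    v.length = n := by
  obtain ⟨x, -, rfl⟩ := hv
  simp

open Classical in
/-- The total weight of the words of a subshift, a letter having weight `exp (-τ)`, is finite as soon
as `τ` exceeds the entropy. -/
lemma tsum_words_exp_ne_top (S : Subshift m) {τ : ℝ} (hτ : S.entropy < τ) :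
    ∑' v : List (Fin m), (if v ∈ S.words v.length then
      ENNReal.ofReal (Real.exp (-(τ * v.length))) else 0) ≠ ∞ := by
  obtain ⟨η, h1, h2⟩ := exists_between hτ
  rw [← (Equiv.sigmaFiberEquiv (List.length : List (Fin m) → ℕ)).tsum_eq, ENNReal.tsum_sigma']
  have hin : ∀ n : ℕ, ∑' v : {v : List (Fin m) // v.length = n},
      (if (v : List (Fin m)) ∈ S.words (v : List (Fin m)).length then
        ENNReal.ofReal (Real.exp (-(τ * (v : List (Fin m)).length))) else 0) =
      ENNReal.ofReal ((S.words n).ncard * Real.exp (-(τ * n))) := by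
    intro n
    calc _ = ∑' v : {v : List (Fin m) // v.length = n},
        (S.words n).indicator (fun _ => ENNReal.ofReal (Real.exp (-(τ * n)))) (v : List (Fin m)) := by
          refine tsum_congr fun v => ?_
          rw [v.2, Set.indicator_apply]
      _ = ∑' v : List (Fin m),
        (S.words n).indicator (fun _ => ENNReal.ofReal (Real.exp (-(τ * n)))) v := by
          refine tsum_subtype_eq_of_support_subset (s := {v : List (Fin m) | v.length = n})
            fun v hv => ?_
          exact length_of_mem_words (Set.mem_of_indicator_ne_zero hv)
      _ = _ := by
          rw [← tsum_subtype, ENNReal.tsum_const, ENNReal.ofReal_mul (by positivity)]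
          congr 1
          rw [ENat.card_coe_set_eq, ← (S.words_finite n).cast_ncard_eq]
          simp
  have : ∀ n : ℕ, (∑' v : {v : List (Fin m) // v.length = n},
      (if (Equiv.sigmaFiberEquiv (List.length : List (Fin m) → ℕ)) ⟨n, v⟩ ∈
          S.words ((Equiv.sigmaFiberEquiv (List.length : List (Fin m) → ℕ)) ⟨n, v⟩).length then
        ENNReal.ofReal (Real.exp (-(τ * ((Equiv.sigmaFiberEquiv
          (List.length : List (Fin m) → ℕ)) ⟨n, v⟩).length))) else 0)) =
      ENNReal.ofReal ((S.words n).ncard * Real.exp (-(τ * n))) := hin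
  simp_rw [this]
  have hsum : Summable fun n : ℕ => ((S.words n).ncard : ℝ) * Real.exp (-(τ * n)) := by
    have hg : Summable fun n : ℕ => Real.exp (η - τ) ^ n :=
      summable_geometric_of_lt_one (Real.exp_pos _).le (by rw [Real.exp_lt_one_iff]; linarith)
    refine hg.of_norm_bounded_eventually_nat ?_
    filter_upwards [S.tendsto_entropy.eventually_lt_const h1, eventually_gt_atTop 0] with n hn hn0
    have hn0' : (0 : ℝ) < n := by exact_mod_cast hn0
    rw [div_lt_iff₀ hn0'] at hn
    rw [Real.norm_of_nonneg (by positivity), ← Real.exp_nat_mul]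
    rcases Nat.eq_zero_or_pos (S.words n).ncard with h0 | h0
    · rw [h0]; simp [Real.exp_nonneg]
    · rw [← Real.exp_log (show (0 : ℝ) < (S.words n).ncard by exact_mod_cast h0), ← Real.exp_add]
      exact Real.exp_le_exp.2 (by nlinarith)
  rw [← ENNReal.ofReal_tsum_of_nonneg (fun n => by positivity) hsum]
  exact ENNReal.ofReal_ne_top

/-- Cylinders of all lengths are used at once: every point lies in one of each length, hence in
infinitely many, and their weights are summable above the entropy. -/
lemma dimH_carrier_le (S : Subshift m) (hm : 2 ≤ m) (h0 : 0 ≤ S.entropy) :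
    dimH S.carrier ≤ ENNReal.ofReal (S.entropy / Real.log m) := by
  have hlog : 0 < Real.log m := Real.log_pos (by exact_mod_cast hm)
  refine le_of_forall_gt fun r hr => ?_
  obtain ⟨s, hs1, hs2⟩ := ENNReal.lt_iff_exists_nnreal_btwn.1 hr
  have hs : S.entropy / Real.log m < s := by
    rw [← ENNReal.ofReal_coe_nnreal] at hs1
    exact (ENNReal.ofReal_lt_ofReal_iff_of_nonneg (by positivity)).1 hs1
  have hs0 : (0 : ℝ) < s := lt_of_le_of_lt (by positivity) hs
  rw [div_lt_iff₀ hlog] at hs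
  refine lt_of_le_of_lt ?_ hs2
  rw [← ENNReal.ofReal_coe_nnreal]
  refine dimH_le_of_infinite_cover hs0
    (fun v : List (Fin m) => {x ∈ S.carrier | x.firstLetters v.length = v}) ?_ fun x hx => ?_
  · classical
    refine ne_top_of_le_ne_top (S.tsum_words_exp_ne_top hs) (ENNReal.tsum_le_tsum fun v => ?_)
    split_ifs with hv
    · refine ediam_rpow_le_of_agree (by omega) hs0.le ?_
      rintro x ⟨-, hx⟩ y ⟨-, hy⟩
      exact firstLetters_eq_iff.1 (hx.trans hy.symm)
    · have : {x ∈ S.carrier | x.firstLetters v.length = v} = ∅ := by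
        ext x
        simp only [Set.mem_ofPred_eq, Set.mem_empty_iff_false, iff_false, not_and]
        exact fun hx he => hv ⟨x, hx, he⟩
      rw [this, Metric.ediam_empty, ENNReal.zero_rpow_of_pos hs0]
  · refine (Set.infinite_range_of_injective (f := fun n => x.firstLetters n) fun a b hab => ?_).mono ?_
    · simpa using congrArg List.length hab
    · rintro _ ⟨n, rfl⟩
      simpa using hx

end Subshift

/-! ### The extremal problem for the uncovered proportion. -/

/-- If `n`, `L` are sequences with `b * n (k+1) ≤ L k` and `n k + L k ≤ n (k+1)`, then the proportion of
`[0, n k + L k)` not covered by the intervals `[n i, n i + L i)` is infinitely often at most any number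
above `((1 - b) / (1 + b)) ^ 2`. -/
lemma exists_uncovered_le {n L : ℕ → ℕ} {b δ : ℝ} (hb0 : 0 < b) (hb1 : b < 1)
    (hδ : ((1 - b) / (1 + b)) ^ 2 < δ) (h0 : 1 ≤ n 0) (hn : ∀ k, n k + L k ≤ n (k + 1))
    (hL : ∀ k, b * n (k + 1) ≤ L k) (K : ℕ) :
    ∃ k ≥ K, (n k : ℝ) - ∑ i ∈ Finset.range k, (L i : ℝ) ≤ δ * (n k + L k) := by
  have hδ0 : 0 < δ := lt_of_le_of_lt (by positivity) hδ
  rcases le_or_gt 1 δ with hδ1 | hδ1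
  · refine ⟨K, le_rfl, ?_⟩
    have h1 : (0 : ℝ) ≤ ∑ i ∈ Finset.range K, (L i : ℝ) := by positivity
    have h2 : (0 : ℝ) ≤ L K := by positivity
    have h3 : (0 : ℝ) ≤ n K := by positivity
    nlinarith
  -- If the bound fails from `K` on, the ratios `r = A (k + 2) / A (k + 1)` and `r' = A (k + 3) / A
  -- (k + 2)` satisfy `b δ r' < P - (1 - δ) / r`. By AM–GM, `b δ r + (1 - δ) / r ≥ R`, so `b δ r`
  -- loses at least `R - P` at each step. The hypothesis on `δ` is exactly `P < R`, and a positive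
  -- quantity cannot decrease so forever.
  by_contra! hcon
  set A : ℕ → ℝ := fun k => ∑ i ∈ Finset.range k, (L i : ℝ) with hA
  have hAs : ∀ k, A (k + 1) = A k + L k := fun k => Finset.sum_range_succ _ _
  have hmono : Monotone n := monotone_nat_of_le_succ fun k => (Nat.le_add_right _ _).trans (hn k)
  have hLpos : ∀ k, (0 : ℝ) < L k := fun k => by
    have : (1 : ℝ) ≤ n (k + 1) := by exact_mod_cast h0.trans (hmono (Nat.zero_le _))
    exact lt_of_lt_of_le (by positivity) (hL k)
  have hApos : ∀ k, 0 < A (k + 1) := fun k => by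
    rw [hAs]
    exact add_pos_of_nonneg_of_pos (by positivity) (hLpos k)
  have hkey : (1 - δ) * (1 - b) ^ 2 < 4 * b * δ := by
    rw [div_pow, div_lt_iff₀ (by positivity)] at hδ
    nlinarith
  set P := (1 - δ) * (1 - b) with hP
  have hP0 : 0 ≤ P := mul_nonneg (by linarith) (by linarith)
  set R := √(4 * b * δ * (1 - δ)) with hR
  have hR2 : R ^ 2 = 4 * b * δ * (1 - δ) :=
    Real.sq_sqrt (mul_nonneg (by positivity) (by linarith))
  have hPR : P < R := by
    refine Real.lt_sqrt_of_sq_lt ?_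
    have : P ^ 2 = (1 - δ) * ((1 - δ) * (1 - b) ^ 2) := by rw [hP]; ring
    rw [this]
    nlinarith
  have hstep : ∀ k, K ≤ k + 2 → b * δ * (A (k + 3) / A (k + 2)) ≤
      b * δ * (A (k + 2) / A (k + 1)) - (R - P) := by
    intro k hk
    have h1 := hcon (k + 2) hk
    change δ * (n (k + 2) + L (k + 2)) < n (k + 2) - A (k + 2) at h1
    have h2 := hL (k + 1)
    have h3 := hAs (k + 1)
    have h4 := hAs (k + 2)
    have h5 : (1 - δ) * (A (k + 2) - A (k + 1)) > b * (A (k + 2) + δ * (A (k + 3) - A (k + 2))) := by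
      have : (1 - δ) * (b * n (k + 2)) ≤ (1 - δ) * L (k + 1) :=
        mul_le_mul_of_nonneg_left h2 (by linarith)
      have h6 : b * (A (k + 2) + δ * L (k + 2)) < b * ((1 - δ) * n (k + 2)) :=
        mul_lt_mul_of_pos_left (by linarith) hb0
      have e1 : A (k + 2) - A (k + 1) = L (k + 1) := by linarith
      have e2 : A (k + 3) - A (k + 2) = L (k + 2) := by linarith
      rw [e1, e2]
      linarith
    have p1 := hApos k
    have p2 := hApos (k + 1)
    have hx : b * δ * A (k + 3) ≤ b * δ * (A (k + 2) * A (k + 2) / A (k + 1)) - (R - P) * A (k + 2) := by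
      -- The AM–GM inequality, written as a square.
      have q : 0 ≤ (2 * b * δ * A (k + 2) - R * A (k + 1)) ^ 2 / (4 * b * δ * A (k + 1)) := by
        positivity
      have q' : (2 * b * δ * A (k + 2) - R * A (k + 1)) ^ 2 / (4 * b * δ * A (k + 1)) =
          b * δ * (A (k + 2) * A (k + 2) / A (k + 1)) - R * A (k + 2) + (1 - δ) * A (k + 1) := by
        have : (2 * b * δ * A (k + 2) - R * A (k + 1)) ^ 2 = 4 * b * δ * (b * δ * (A (k + 2) * A (k + 2))
          - R * A (k + 2) * A (k + 1) + (1 - δ) * A (k + 1) * A (k + 1)) := by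
          linear_combination A (k + 1) ^ 2 * hR2
        rw [this]
        field_simp
      rw [q'] at q
      rw [hP]
      linarith
    calc b * δ * (A (k + 3) / A (k + 2)) = (b * δ * A (k + 3)) / A (k + 2) := by ring
      _ ≤ (b * δ * (A (k + 2) * A (k + 2) / A (k + 1)) - (R - P) * A (k + 2)) / A (k + 2) :=
        div_le_div_of_nonneg_right hx p2.le
      _ = _ := by field_simp
  have hdec : ∀ j : ℕ, b * δ * (A (K + j + 2) / A (K + j + 1)) ≤
      b * δ * (A (K + 2) / A (K + 1)) - j * (R - P) := by
    intro j
    induction j with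
    | zero => simp
    | succ j ih =>
      have := hstep (K + j) (by omega)
      push_cast
      rw [show K + (j + 1) + 2 = K + j + 3 by ring, show K + (j + 1) + 1 = K + j + 2 by ring]
      linarith
  obtain ⟨j, hj⟩ := exists_nat_gt (b * δ * (A (K + 2) / A (K + 1)) / (R - P))
  rw [div_lt_iff₀ (by linarith)] at hj
  have h1 := hdec j
  have h2 : 0 < b * δ * (A (K + j + 2) / A (K + j + 1)) :=
    mul_pos (by positivity) (div_pos (hApos _) (hApos _))
  linarith

/-! ### Record zero runs. -/

namespace SymbolicSpace
variable {m : ℕ}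

/-- The record zero blocks of a word all of whose prefixes see a zero block of proportional length. -/
lemma exists_record_blocks [NeZero m] {x : SymbolicSpace m} {b : ℝ} (hb : 0 < b)
    (hx : ∀ n, ∃ i ≥ n, x i ≠ 0)
    (H : ∀ᶠ N : ℕ in atTop, ∃ n k : ℕ, 1 ≤ n ∧ n ≤ N ∧ b * (N + 1 : ℕ) ≤ k ∧ ∀ j < k, x (n + j) = 0) :
    ∃ n L : ℕ → ℕ, 1 ≤ n 0 ∧ (∀ k, n k + L k ≤ n (k + 1)) ∧ (∀ k, b * n (k + 1) ≤ L k) ∧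
      ∀ k, ∀ j < L k, x (n k + j) = 0 := by
  obtain ⟨N₀, H⟩ := eventually_atTop.1 H
  have hx' : ∀ n, ∃ j, x (n + j) ≠ 0 := fun n => by
    obtain ⟨i, hi, hxi⟩ := hx n
    exact ⟨i - n, by rwa [Nat.add_sub_cancel' hi]⟩
  have hrun : ∀ n, ∃ l, (∀ j < l, x (n + j) = 0) ∧ x (n + l) ≠ 0 := fun n =>
    ⟨Nat.find (hx' n), fun j hj => by simpa using Nat.find_min (hx' n) hj, Nat.find_spec (hx' n)⟩
  choose ℓ hℓ0 hℓ1 using hrun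
  have hmax : ∀ n k, (∀ j < k, x (n + j) = 0) → k ≤ ℓ n := fun n k h => by
    by_contra! hlt
    exact hℓ1 n (h _ hlt)
  -- Inside a zero run, later starting points see only the rest of that run, so the next record
  -- starts after its end.
  have hlater : ∀ n n', n ≤ n' → n' < n + ℓ n → ℓ n' ≤ ℓ n := fun n n' h1 h2 => by
    by_contra! hlt
    have := hℓ0 n' (n + ℓ n - n') (by omega)
    rw [Nat.add_sub_cancel' h2.le] at this
    exact hℓ1 n this
  let Rec : ℕ → Prop := fun n => 1 ≤ n ∧ ∀ n' < n, 1 ≤ n' → ℓ n' < ℓ n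
  have hfirst : ∀ l, ∃ n, Rec n ∧ l < ℓ n ∧ ∀ n' < n, 1 ≤ n' → ℓ n' ≤ l := fun l => by
    have hex : ∃ n, 1 ≤ n ∧ l < ℓ n := by
      obtain ⟨N, hN⟩ := exists_nat_gt (l / b)
      rw [div_lt_iff₀ hb] at hN
      obtain ⟨n, k, h1, -, h3, h4⟩ := H (max N N₀) (le_max_right _ _)
      refine ⟨n, h1, lt_of_lt_of_le ?_ (hmax n k h4)⟩
      have : (N : ℝ) ≤ (max N N₀ + 1 : ℕ) := by exact_mod_cast (le_max_left _ _).trans (Nat.le_succ _)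
      have : (l : ℝ) < k := by nlinarith
      exact_mod_cast this
    classical
    have hs := Nat.find_spec hex
    have hm : ∀ n' < Nat.find hex, 1 ≤ n' → ℓ n' ≤ l := fun n' h1 h2 => by
      by_contra! h
      exact Nat.find_min hex h1 ⟨h2, h⟩
    exact ⟨Nat.find hex, ⟨hs.1, fun n' h1 h2 => (hm n' h1 h2).trans_lt hs.2⟩, hs.2, hm⟩
  have hnext : ∀ n : {n // Rec n ∧ N₀ ≤ n}, ∃ n' : {n // Rec n ∧ N₀ ≤ n},
      (n : ℕ) + ℓ n ≤ n' ∧ b * (n' : ℕ) ≤ ℓ n := by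
    rintro ⟨n, hn, hnN⟩
    obtain ⟨n', hr, h1, h2⟩ := hfirst (ℓ n)
    have h3 : n + ℓ n ≤ n' := by
      by_contra! hlt
      rcases lt_or_ge n' n with h | h
      · exact absurd (hn.2 n' h hr.1) (by omega)
      · exact absurd (hlater n n' h hlt) (by omega)
    have h4 : n < n' := by
      rcases (show n ≤ n' by omega).lt_or_eq with h | h
      · exact h
      · subst h; omega
    refine ⟨⟨n', hr, by omega⟩, h3, ?_⟩
    -- Here `n'` is the first start whose run exceeds `ℓ n`. The run provided at `N = n' - 1` starts
    -- earlier, so its length is at most `ℓ n`. The factor `N + 1` in `H` turns this into a bound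
    -- with `n'` itself.
    obtain ⟨p, k, p1, p2, p3, p4⟩ := H (n' - 1) (by omega)
    rw [Nat.sub_add_cancel hr.1] at p3
    refine p3.trans ?_
    exact_mod_cast (hmax p k p4).trans (h2 p (by have := hr.1; omega) p1)
  have hstart : ∃ n, Rec n ∧ N₀ ≤ n := by
    obtain ⟨n, hr, h1, -⟩ := hfirst ((Finset.range N₀).sup ℓ)
    refine ⟨n, hr, ?_⟩
    by_contra! hlt
    exact absurd (Finset.le_sup (f := ℓ) (Finset.mem_range.2 hlt)) (by omega)
  choose nx hnx1 hnx2 using hnext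
  obtain ⟨n₀, hn₀⟩ := hstart
  let a : ℕ → {n // Rec n ∧ N₀ ≤ n} := fun k => nx^[k] ⟨n₀, hn₀⟩
  have ha : ∀ k, a (k + 1) = nx (a k) := fun k => Function.iterate_succ_apply' _ _ _
  refine ⟨fun k => a k, fun k => ℓ (a k), hn₀.1.1, fun k => ?_, fun k => ?_, fun k => hℓ0 _⟩
  · dsimp only; rw [ha]; exact hnx1 _
  · dsimp only; rw [ha]; exact hnx2 _

end SymbolicSpace

/-! ### Upper bound by coded cylinders. -/

lemma summable_pow_mul_exp_neg_pow {G c ρ : ℝ} (hG : 0 ≤ G) (hc : 0 < c) (hρ : 1 < ρ) :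
    Summable fun k : ℕ => G ^ k * Real.exp (-(c * ρ ^ k)) := by
  have hg : Summable fun k : ℕ => Real.exp (-1) ^ k :=
    summable_geometric_of_lt_one (Real.exp_pos _).le (by rw [Real.exp_lt_one_iff]; norm_num)
  refine hg.of_norm_bounded_eventually_nat ?_
  have hl : 0 ≤ Real.log (G + 1) := Real.log_nonneg (by linarith)
  have hlim := tendsto_pow_const_div_const_pow_of_one_lt 1 hρ
  filter_upwards [hlim.eventually_lt_const (show 0 < c / (Real.log (G + 1) + 1) by positivity)]
    with k hk
  have hρk : 0 < ρ ^ k := by positivity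
  rw [pow_one, div_lt_div_iff₀ hρk (by positivity)] at hk
  rw [Real.norm_of_nonneg (by positivity)]
  calc G ^ k * Real.exp (-(c * ρ ^ k)) ≤ (G + 1) ^ k * Real.exp (-(c * ρ ^ k)) := by
        gcongr; linarith
    _ = Real.exp (k * Real.log (G + 1) - c * ρ ^ k) := by
        rw [sub_eq_add_neg, Real.exp_add, Real.exp_nat_mul, Real.exp_log (by linarith)]
    _ ≤ Real.exp (k * (-1)) := Real.exp_le_exp.2 (by nlinarith)
    _ = _ := Real.exp_nat_mul _ _

/-- The end of the `k`-th pair of intervals when intervals of lengths `f 0, L 0, f 1, L 1, …` are put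
one after the other. -/
def blockEnd (f L : ℕ → ℕ) (k : ℕ) : ℕ := ∑ j ∈ Finset.range k, (f j + L j)

lemma blockEnd_succ (f L : ℕ → ℕ) (k : ℕ) : blockEnd f L (k + 1) = blockEnd f L k + (f k + L k) :=
  Finset.sum_range_succ _ _

namespace Subshift
open SymbolicSpace
variable {m : ℕ} [NeZero m]

/-- The points of `S` starting with `v₀ 0^{l₀} ⋯ v_{k-1} 0^{l_{k-1}}`, where `c i = (v_i, l_i)`, provided that the
words `v_i` occupy at most the proportion `δ` of this prefix and its length is at least `θ * ρ ^ k`. -/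
def codedSet (S : Subshift m) (δ θ ρ : ℝ) (c : Σ k : ℕ, Fin k → List (Fin m) × ℕ) :
    Set (SymbolicSpace m) :=
  {x ∈ S.carrier | ∃ f L : ℕ → ℕ,
    (∀ i : Fin c.1, c.2 i = ((shift^[blockEnd f L i] x).firstLetters (f i), L i) ∧
      ∀ j < L i, x (blockEnd f L i + f i + j) = 0) ∧
    (∑ i ∈ Finset.range c.1, (f i : ℝ)) ≤ δ * blockEnd f L c.1 ∧ θ * ρ ^ c.1 ≤ blockEnd f L c.1}

/-- The code determines the lengths `f i`, `L i` and all letters up to `blockEnd`, so a coded set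
lies in a single cylinder of that length. -/
lemma agree_of_mem_codedSet {S : Subshift m} {δ θ ρ : ℝ} {c : Σ k : ℕ, Fin k → List (Fin m) × ℕ}
    {x y : SymbolicSpace m} (hy : y ∈ S.codedSet δ θ ρ c) {f L : ℕ → ℕ}
    (hx : ∀ i : Fin c.1, c.2 i = ((shift^[blockEnd f L i] x).firstLetters (f i), L i) ∧
      ∀ j < L i, x (blockEnd f L i + f i + j) = 0) :
    ∀ p < blockEnd f L c.1, x p = y p := by
  obtain ⟨-, f', L', hy, -⟩ := hy
  have key : ∀ k ≤ c.1, blockEnd f L k = blockEnd f' L' k ∧ ∀ p < blockEnd f L k, x p = y p := by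
    intro k
    induction k with
    | zero => simp [blockEnd]
    | succ k ih =>
      intro hk
      obtain ⟨h1, h2⟩ := ih (by omega)
      obtain ⟨a1, a2⟩ := hx ⟨k, hk⟩
      obtain ⟨b1, b2⟩ := hy ⟨k, hk⟩
      rw [a1] at b1
      dsimp only at b1 a2 b2
      obtain ⟨e1, e2⟩ := Prod.mk.inj b1
      have e3 : f k = f' k := by simpa using congrArg List.length e1
      rw [blockEnd_succ, blockEnd_succ, h1, e3, e2]
      refine ⟨rfl, fun p hp => ?_⟩
      rcases lt_or_ge p (blockEnd f L k) with h | h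
      · exact h2 p h
      rcases lt_or_ge p (blockEnd f L k + f k) with h' | h'
      · rw [← e3, ← h1] at e1
        have := firstLetters_eq_iff.1 e1 (p - blockEnd f L k) (by omega)
        rwa [shift_iterate_apply, shift_iterate_apply, Nat.add_sub_cancel' h] at this
      · have q1 := a2 (p - (blockEnd f L k + f k)) (by omega)
        have q2 := b2 (p - (blockEnd f L k + f k)) (by omega)
        rw [← h1, ← e3] at q2
        rw [Nat.add_sub_cancel' h'] at q1 q2
        rw [q1, q2]
  exact (key _ le_rfl).2

-- The exponent available per letter of the prefix is `s * log m`. The part `δ * τ` pays for the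
-- free words, which fill at most the proportion `δ`. One `η` pays for the choice of the run
-- lengths, and the other yields the factor decaying like `exp (-c ρ ^ k)`.
open Classical in
lemma ediam_codedSet_rpow_le (S : Subshift m) {δ θ ρ s τ η : ℝ} (hs : 0 < s) (hη : 0 ≤ η) (hτ : 0 ≤ τ)
    (h : δ * τ + 2 * η ≤ s * Real.log m) (c : Σ k : ℕ, Fin k → List (Fin m) × ℕ) :
    Metric.ediam (S.codedSet δ θ ρ c) ^ s ≤
      (∏ i, ((if (c.2 i).1 ∈ S.words (c.2 i).1.length then
        ENNReal.ofReal (Real.exp (-(τ * (c.2 i).1.length))) else 0) *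
        ENNReal.ofReal (Real.exp (-η) ^ (c.2 i).2))) *
      ENNReal.ofReal (Real.exp (-(η * θ * ρ ^ c.1))) := by
  rcases (S.codedSet δ θ ρ c).eq_empty_or_nonempty with h0 | ⟨x, hx⟩
  · rw [h0, Metric.ediam_empty, ENNReal.zero_rpow_of_pos hs]
    exact zero_le
  obtain ⟨hxS, f, L, hc, h1, h2⟩ := id hx
  have hd := ediam_rpow_le_of_agree (NeZero.pos m) hs.le (t := S.codedSet δ θ ρ c)
    (N := blockEnd f L c.1)
    fun y hy z hz i hi => (agree_of_mem_codedSet hy hc i hi).symm.trans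
      (agree_of_mem_codedSet hz hc i hi)
  refine hd.trans ?_
  have hw : ∀ i, (c.2 i).1 ∈ S.words (c.2 i).1.length := fun i => by
    rw [(hc i).1]
    exact ⟨shift^[blockEnd f L i] x, S.shift_iterate_mem _ hxS, by simp⟩
  have hprod : (∏ i, ((if (c.2 i).1 ∈ S.words (c.2 i).1.length then
        ENNReal.ofReal (Real.exp (-(τ * (c.2 i).1.length))) else 0) *
        ENNReal.ofReal (Real.exp (-η) ^ (c.2 i).2))) =
      ENNReal.ofReal (Real.exp (∑ i ∈ Finset.range c.1, (-(τ * f i) + -(η * L i)))) := by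
    rw [Real.exp_sum, ENNReal.ofReal_prod_of_nonneg (fun i _ => (Real.exp_pos _).le),
      ← Fin.prod_univ_eq_prod_range (fun i => ENNReal.ofReal (Real.exp (-(τ * f i) + -(η * L i))))]
    refine Finset.prod_congr rfl fun i _ => ?_
    rw [if_pos (hw i), (hc i).1, Real.exp_add, ENNReal.ofReal_mul (Real.exp_pos _).le,
      ← Real.exp_nat_mul, length_firstLetters]
    congr 3
    dsimp only
    ring
  rw [hprod, ← ENNReal.ofReal_mul (Real.exp_pos _).le, ← Real.exp_add]
  refine ENNReal.ofReal_le_ofReal (Real.exp_le_exp.2 ?_)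
  have hE : (blockEnd f L c.1 : ℝ) =
      ∑ i ∈ Finset.range c.1, (f i : ℝ) + ∑ i ∈ Finset.range c.1, (L i : ℝ) := by
    rw [blockEnd, Finset.sum_add_distrib]; push_cast; rfl
  have hF : (0 : ℝ) ≤ ∑ i ∈ Finset.range c.1, (f i : ℝ) := by positivity
  have hEnn : (0 : ℝ) ≤ blockEnd f L c.1 := by positivity
  rw [Finset.sum_add_distrib, Finset.sum_neg_distrib, Finset.sum_neg_distrib, ← Finset.mul_sum,
    ← Finset.mul_sum]
  have a1 := mul_le_mul_of_nonneg_right h hEnn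
  have a2 := mul_le_mul_of_nonneg_left h1 hτ
  have a3 := mul_le_mul_of_nonneg_left h2 hη
  have a4 : η * ∑ i ∈ Finset.range c.1, (L i : ℝ) ≤ η * blockEnd f L c.1 :=
    mul_le_mul_of_nonneg_left (by linarith) hη
  nlinarith

/-- The weights are multiplicative, so codes with `k` pairs contribute `G ^ k`, with `G` the total
weight of one pair. The factor `exp (-(η * θ * ρ ^ k))` beats this. -/
lemma tsum_ediam_codedSet_ne_top (S : Subshift m) {δ θ ρ s τ η : ℝ} (hs : 0 < s) (hη : 0 < η)
    (hτ0 : 0 ≤ τ) (hτ : S.entropy < τ) (hθ : 0 < θ) (hρ : 1 < ρ)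
    (h : δ * τ + 2 * η ≤ s * Real.log m) :
    ∑' c, Metric.ediam (S.codedSet δ θ ρ c) ^ s ≠ ∞ := by
  classical
  refine ne_top_of_le_ne_top ?_ (ENNReal.tsum_le_tsum
    fun c => S.ediam_codedSet_rpow_le hs hη.le hτ0 h c)
  rw [ENNReal.tsum_sigma']
  set g : List (Fin m) × ℕ → ℝ≥0∞ := fun p => (if p.1 ∈ S.words p.1.length then
        ENNReal.ofReal (Real.exp (-(τ * p.1.length))) else 0) *
        ENNReal.ofReal (Real.exp (-η) ^ p.2) with hg
  have hG : ∑' p, g p ≠ ∞ := by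
    rw [ENNReal.tsum_prod']
    simp_rw [hg, ENNReal.tsum_mul_left, ENNReal.tsum_mul_right]
    refine ENNReal.mul_ne_top (S.tsum_words_exp_ne_top hτ) ?_
    rw [← ENNReal.ofReal_tsum_of_nonneg (fun n => by positivity)
      (summable_geometric_of_lt_one (Real.exp_pos _).le (by rw [Real.exp_lt_one_iff]; linarith))]
    exact ENNReal.ofReal_ne_top
  obtain ⟨G, hG⟩ : ∃ G : NNReal, (G : ℝ≥0∞) = ∑' p, g p := ⟨_, ENNReal.coe_toNNReal hG⟩
  have hk : ∀ k : ℕ, ∑' c : Fin k → List (Fin m) × ℕ, (∏ i, g (c i)) *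
      ENNReal.ofReal (Real.exp (-(η * θ * ρ ^ k))) =
      ENNReal.ofReal ((G : ℝ) ^ k * Real.exp (-(η * θ * ρ ^ k))) := by
    intro k
    rw [ENNReal.tsum_mul_right, ENNReal.tsum_fin_pi_prod, ← hG, ENNReal.ofReal_mul (by positivity),
      ENNReal.ofReal_pow (by positivity), ENNReal.ofReal_coe_nnreal]
  refine ne_of_eq_of_ne (tsum_congr hk) ?_
  rw [← ENNReal.ofReal_tsum_of_nonneg (fun n => by positivity)
    (summable_pow_mul_exp_neg_pow (by positivity) (by positivity) hρ)]
  exact ENNReal.ofReal_ne_top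

/-- The points of `S` having disjoint zero blocks `[n k, n k + L k)` with `L k ≥ b * n (k + 1)`. -/
def longBlockSet (S : Subshift m) (b : ℝ) : Set (SymbolicSpace m) :=
  {x ∈ S.carrier | ∃ n L : ℕ → ℕ, 1 ≤ n 0 ∧ (∀ k, n k + L k ≤ n (k + 1)) ∧
    (∀ k, b * n (k + 1) ≤ L k) ∧ ∀ k, ∀ j < L k, x (n k + j) = 0}

lemma infinite_codedSet {S : Subshift m} {b δ : ℝ} (hb0 : 0 < b) (hb1 : b < 1)
    (hδ : ((1 - b) / (1 + b)) ^ 2 < δ) {x : SymbolicSpace m} (hx : x ∈ S.longBlockSet b) :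
    {c | x ∈ S.codedSet δ (1 - b) (1 / (1 - b)) c}.Infinite := by
  obtain ⟨hxS, n, L, h0, hn, hL, hz⟩ := hx
  have hb' : 0 < 1 - b := by linarith
  let f : ℕ → ℕ := fun i => n i - match i with
    | 0 => 0
    | i + 1 => n i + L i
  have hef : ∀ i, blockEnd f L i + f i = n i := by
    intro i
    induction i with
    | zero => simp [blockEnd, f]
    | succ i ih =>
      rw [blockEnd_succ, ← add_assoc, ih]
      exact Nat.add_sub_cancel' (hn i)
  have he : ∀ k, blockEnd f L (k + 1) = n k + L k := fun k => by
    rw [blockEnd_succ, ← add_assoc, hef]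
  -- From `n k ≤ n (k + 1) - L k ≤ (1 - b) * n (k + 1)`. A code ending at run `k` has `k + 1` pairs,
  -- which is why `θ = 1 - b`.
  have hgrow : ∀ k, (1 / (1 - b)) ^ k ≤ (n k : ℝ) := by
    intro k
    induction k with
    | zero => simpa using h0
    | succ k ih =>
      have h1 : (n k : ℝ) + L k ≤ n (k + 1) := by exact_mod_cast hn k
      have h2 := hL k
      rw [pow_succ, mul_one_div, div_le_iff₀ hb']
      linarith
  refine Set.Infinite.of_image Sigma.fst (Set.infinite_of_forall_exists_gt fun K => ?_)
  obtain ⟨k, hk, hF⟩ := exists_uncovered_le hb0 hb1 hδ h0 hn hL K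
  refine ⟨k + 1, ⟨⟨k + 1, fun i => ((shift^[blockEnd f L i] x).firstLetters (f i), L i)⟩, ?_, rfl⟩,
    by omega⟩
  refine ⟨hxS, f, L, fun i => ⟨rfl, fun j hj => ?_⟩, ?_, ?_⟩
  · rw [hef]; exact hz _ j hj
  · rw [he]
    push_cast
    refine le_trans (le_of_eq ?_) hF
    have h1 : (blockEnd f L (k + 1) : ℝ) = ∑ i ∈ Finset.range (k + 1), (f i : ℝ) +
        (∑ i ∈ Finset.range k, (L i : ℝ) + L k) := by
      rw [blockEnd, Finset.sum_add_distrib, ← Finset.sum_range_succ]; push_cast; rfl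
    rw [he] at h1
    push_cast at h1
    linarith
  · rw [he]
    push_cast
    have h1 := hgrow k
    have h2 : (0 : ℝ) ≤ L k := by positivity
    have : (1 - b) * (1 / (1 - b)) ^ (k + 1) = (1 / (1 - b)) ^ k := by
      rw [pow_succ]; field_simp
    rw [this]
    linarith

lemma dimH_longBlockSet_le (S : Subshift m) {b s : ℝ} (hb0 : 0 < b) (hb1 : b < 1)
    (h0 : 0 ≤ S.entropy) (hs0 : 0 < s) (hs : ((1 - b) / (1 + b)) ^ 2 * S.entropy < s * Real.log m) :
    dimH (S.longBlockSet b) ≤ ENNReal.ofReal s := by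
  set d := ((1 - b) / (1 + b)) ^ 2 with hd
  have hd0 : 0 ≤ d := by positivity
  obtain ⟨ε, hε0, hε⟩ : ∃ ε > 0, (d + ε) * (S.entropy + ε) < s * Real.log m := by
    have hc : Tendsto (fun ε : ℝ => (d + ε) * (S.entropy + ε)) (𝓝[>] 0) (𝓝 ((d + 0) * (S.entropy + 0))) :=
      Continuous.continuousWithinAt (by fun_prop)
    rw [add_zero, add_zero] at hc
    obtain ⟨ε, h1, h2⟩ := ((hc.eventually_lt_const hs).and self_mem_nhdsWithin).exists
    exact ⟨ε, h2, h1⟩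
  refine dimH_le_of_infinite_cover hs0 _ (S.tsum_ediam_codedSet_ne_top hs0
    (η := (s * Real.log m - (d + ε) * (S.entropy + ε)) / 2) (by linarith)
    (by linarith : (0 : ℝ) ≤ S.entropy + ε) (by linarith) (by linarith : (0 : ℝ) < 1 - b)
    ?_ (by linarith)) fun x hx => infinite_codedSet hb0 hb1 (by linarith : d < d + ε) hx
  rw [lt_div_iff₀ (by linarith)]
  linarith

/-- The slack `b < a` turns the lower limit into an eventual bound and absorbs the passage from `N`
to `N + 1`. -/
lemma liminfZeroRunSet_subset (S : Subshift m) {a b : ℝ} (hb0 : 0 < b) (hba : b < a) :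
    S.liminfZeroRunSet a ⊆ (⋃ n, {x | shift^[n] x = zeros m}) ∪ S.longBlockSet b := by
  rintro x ⟨hxS, hx⟩
  by_cases hz : ∃ n, shift^[n] x = zeros m
  · exact Or.inl (Set.mem_iUnion.2 hz)
  simp only [shift_iterate_eq_zeros_iff] at hz
  push Not at hz
  obtain ⟨b', h1, h2⟩ := exists_between hba
  refine Or.inr ⟨hxS, exists_record_blocks hb0 hz ?_⟩
  have hlt : ENNReal.ofReal b' < ENNReal.ofReal a :=
    (ENNReal.ofReal_lt_ofReal_iff (by linarith)).2 h2
  have hl : Tendsto (fun N : ℕ => (b' - b) * (N : ℝ)) atTop atTop :=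
    tendsto_natCast_atTop_atTop.const_mul_atTop (by linarith)
  filter_upwards [exists_zero_block_of_lt_liminf (by linarith) (hlt.trans_le hx),
    hl.eventually_ge_atTop b] with N hN hN'
  obtain ⟨n, k, a1, a2, a3, a4⟩ := hN
  refine ⟨n, k, a1, a2, ?_, a4⟩
  push_cast
  linarith

lemma dimH_liminfZeroRunSet_le (S : Subshift m) (hm : 2 ≤ m) (h0 : 0 ≤ S.entropy) {a : ℝ} (ha0 : 0 < a)
    (ha1 : a ≤ 1) : dimH (S.liminfZeroRunSet a) ≤
      ENNReal.ofReal (((1 - a) / (1 + a)) ^ 2 * (S.entropy / Real.log m)) := by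
  have hlog : 0 < Real.log m := Real.log_pos (by exact_mod_cast hm)
  refine le_of_forall_gt fun r hr => ?_
  obtain ⟨s, hs1, hs2⟩ := ENNReal.lt_iff_exists_nnreal_btwn.1 hr
  refine lt_of_le_of_lt ?_ hs2
  rw [← ENNReal.ofReal_coe_nnreal] at hs1 ⊢
  have hs := (ENNReal.ofReal_lt_ofReal_iff_of_nonneg (by positivity)).1 hs1
  have hs0 : (0 : ℝ) < s := lt_of_le_of_lt (by positivity) hs
  rw [← mul_div_assoc, div_lt_iff₀ hlog] at hs
  obtain ⟨b, hb, hb0, hba⟩ : ∃ b, ((1 - b) / (1 + b)) ^ 2 * S.entropy < s * Real.log m ∧ 0 < b ∧ b < a := by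
    have hc : Tendsto (fun b : ℝ => ((1 - b) / (1 + b)) ^ 2 * S.entropy) (𝓝[<] a)
        (𝓝 (((1 - a) / (1 + a)) ^ 2 * S.entropy)) := by
      refine ContinuousAt.continuousWithinAt ?_
      have : 1 + a ≠ 0 := by linarith
      fun_prop (disch := assumption)
    exact ((hc.eventually_lt_const hs).and (Ioo_mem_nhdsLT ha0)).exists
  refine (dimH_mono (S.liminfZeroRunSet_subset hb0 hba)).trans ?_
  rw [dimH_union, dimH_countable (Set.countable_iUnion countable_eventually_zero)]
  exact max_le zero_le (S.dimH_longBlockSet_le hb0 (by linarith) h0 hs0 hb)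

end Subshift

/-! ### Gluing by specification and the digit map. -/

/-- The position of the `j`-th block when blocks of lengths `z 0, z 1, …` are separated by gaps of
length `g`. -/
def blockStart (z : ℕ → ℕ) (g j : ℕ) : ℕ := ∑ i ∈ Finset.range j, (z i + g)

lemma blockStart_succ (z : ℕ → ℕ) (g j : ℕ) : blockStart z g (j + 1) = blockStart z g j + (z j + g) :=
  Finset.sum_range_succ _ _

lemma le_blockStart {z : ℕ → ℕ} (hz : ∀ j, 1 ≤ z j) (g j : ℕ) : j ≤ blockStart z g j := by
  induction j with
  | zero => exact Nat.zero_le _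
  | succ j ih => rw [blockStart_succ]; have := hz j; omega

namespace Subshift
open SymbolicSpace
variable {m : ℕ}

lemma mem_carrier_of_forall_agree (S : Subshift m) (hm : 2 ≤ m) {x : SymbolicSpace m}
    (h : ∀ N, ∃ y ∈ S.carrier, ∀ i < N, x i = y i) : x ∈ S.carrier := by
  rw [← S.isClosed.closure_eq]
  refine Metric.mem_closure_iff.2 fun ε hε => ?_
  have h1 : (m : ℝ)⁻¹ < 1 := inv_lt_one_of_one_lt₀ (by exact_mod_cast hm)
  obtain ⟨N, hN⟩ := exists_pow_lt_of_lt_one hε h1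
  obtain ⟨y, hy, hxy⟩ := h N
  refine ⟨y, hy, (dist_le_of_agree hxy).trans_lt (lt_of_le_of_lt ?_ hN)⟩
  exact pow_le_pow_of_le_one (by positivity) h1.le (Nat.le_succ N)

lemma length_pos_of_mem_language {S : Subshift m} {v : List (Fin m)} (hv : v ∈ S.language) :
    1 ≤ v.length := by
  obtain ⟨n, hn, h⟩ := hv
  rwa [length_of_mem_words h]

lemma exists_prefix_of_mem_language {S : Subshift m} {v : List (Fin m)} (hv : v ∈ S.language) :
    ∃ y ∈ S.carrier, y.firstLetters v.length = v := by
  obtain ⟨n, hn, h⟩ := hv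
  rw [length_of_mem_words h]
  exact h

/-- Specification glues infinitely many words. -/
lemma exists_glue [NeZero m] (S : Subshift m) (hm : 2 ≤ m) {M : ℕ}
    (hM : ∀ u ∈ S.language, ∀ v ∈ S.language, ∃ w ∈ S.words M, u ++ w ++ v ∈ S.language)
    (v : ℕ → List (Fin m)) (hv : ∀ j, v j ∈ S.language) :
    ∃ x ∈ S.carrier, ∀ j, ∀ i < (v j).length,
      (v j)[i]? = some (x (blockStart (fun j => (v j).length) M j + i)) := by
  choose! w hw hwM using hM
  let u : ℕ → List (Fin m) := fun k => Nat.rec (v 0) (fun k u => u ++ w u (v (k + 1)) ++ v (k + 1)) k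
  have hu : ∀ k, u (k + 1) = u k ++ w (u k) (v (k + 1)) ++ v (k + 1) := fun k => rfl
  have hul : ∀ k, u k ∈ S.language := by
    intro k
    induction k with
    | zero => exact hv 0
    | succ k ih => exact hwM _ ih _ (hv _)
  have hlen : ∀ k, (u k).length = blockStart (fun j => (v j).length) M k + (v k).length := by
    intro k
    induction k with
    | zero => simp [blockStart, u]
    | succ k ih =>
      rw [hu, List.length_append, List.length_append, ih, blockStart_succ,
        length_of_mem_words (hw _ (hul k) _ (hv (k + 1)))]
      ring
  have hlen' : ∀ k, k < (u k).length := fun k => by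
    rw [hlen]
    have h1 := le_blockStart (z := fun j => (v j).length)
      (fun j => length_pos_of_mem_language (hv j)) M k
    have h2 := length_pos_of_mem_language (hv k)
    omega
  have hpre : ∀ k l, k ≤ l → u k <+: u l := fun k l hkl => by
    induction l, hkl using Nat.le_induction with
    | base => exact List.prefix_rfl
    | succ l _ ih => exact ih.trans ⟨_, by rw [hu, List.append_assoc]⟩
  -- The words `u k` extend one another and `u i` is longer than `i`, so the default value `0` is
  -- never used.
  let x : SymbolicSpace m := fun i => (u i)[i]?.getD 0
  have hx : ∀ k i, i < (u k).length → (u k)[i]? = some (x i) := fun k i hi => by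
    have h1 : (u i)[i]? = some (x i) := by
      simp only [x, List.getElem?_eq_getElem (hlen' i), Option.getD_some]
    rw [← h1]
    rcases le_total k i with h | h
    · exact (List.prefix_iff_getElem?.1 (hpre k i h) i hi ▸ List.getElem?_eq_getElem hi)
    · exact ((List.prefix_iff_getElem?.1 (hpre i k h) i (hlen' i)).trans
        (List.getElem?_eq_getElem (hlen' i)).symm)
  refine ⟨x, S.mem_carrier_of_forall_agree hm fun N => ?_, fun j i hi => ?_⟩
  · obtain ⟨y, hy, hyu⟩ := exists_prefix_of_mem_language (hul N)
    refine ⟨y, hy, fun i hi => ?_⟩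
    have hi' : i < (u N).length := hi.trans (hlen' N)
    have h1 := hx N i hi'
    rw [← hyu, List.getElem?_eq_getElem (by simpa using hi'), getElem_firstLetters] at h1
    exact (Option.some.inj h1).symm
  · have h1 := hx j (blockStart (fun j => (v j).length) M j + i) (by rw [hlen]; omega)
    rw [← h1]
    rcases j with _ | j
    · simp [blockStart, u]
    · have h2 : (u j ++ w (u j) (v (j + 1))).length = blockStart (fun j => (v j).length) M (j + 1) := by
        rw [List.length_append, hlen, blockStart_succ,
          length_of_mem_words (hw _ (hul j) _ (hv (j + 1)))]
        ring
      rw [hu, ← h2, List.getElem?_append_right (Nat.le_add_right _ _), Nat.add_sub_cancel_left]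

/-- Under specification, zero blocks and words of a fixed length can be prescribed alternately. -/
lemma exists_mem_of_blocks [NeZero m] (S : Subshift m) (hm : 2 ≤ m) (h0 : zeros m ∈ S.carrier) {M : ℕ}
    (hM : ∀ u ∈ S.language, ∀ v ∈ S.language, ∃ w ∈ S.words M, u ++ w ++ v ∈ S.language)
    {z : ℕ → ℕ} (hz : ∀ j, 1 ≤ z j) {q : ℕ} (hq : 1 ≤ q) (y : ℕ → List (Fin m))
    (hy : ∀ j, y j ∈ S.words q) :
    ∃ x ∈ S.carrier, ∀ j, (∀ i < z j, x (blockStart z (2 * M + q) j + i) = 0) ∧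
      (shift^[blockStart z (2 * M + q) j + z j + M] x).firstLetters q = y j := by
  have hzw : ∀ j, (zeros m).firstLetters (z j) ∈ S.language := fun j => ⟨z j, hz j, _, h0, rfl⟩
  choose w hw hwM using fun j => hM _ (hzw j) (y j) ⟨q, hq, hy j⟩
  obtain ⟨x, hxS, hx⟩ := S.exists_glue hm hM _ hwM
  have hwl : ∀ j, (w j).length = M := fun j => length_of_mem_words (hw j)
  have hyl : ∀ j, (y j).length = q := fun j => length_of_mem_words (hy j)
  have hP : ∀ j, blockStart (fun j => ((zeros m).firstLetters (z j) ++ w j ++ y j).length) M j =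
      blockStart z (2 * M + q) j := fun j => by
    refine Finset.sum_congr rfl fun i _ => ?_
    simp only [List.length_append, length_firstLetters, hwl, hyl]
    ring
  refine ⟨x, hxS, fun j => ⟨fun i hi => ?_, ?_⟩⟩
  · have h1 := hx j i (by simp; omega)
    rw [hP, List.append_assoc, List.getElem?_append_left (by simpa using hi),
      List.getElem?_eq_getElem (by simpa using hi), getElem_firstLetters] at h1
    exact (Option.some.inj h1).symm
  · refine List.ext_getElem (by simp [hyl]) fun i h1 h2 => ?_
    rw [getElem_firstLetters, shift_iterate_apply]
    have h3 := hx j (z j + M + i) (by simp [hwl]; omega)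
    have h4 : ((zeros m).firstLetters (z j) ++ w j).length = z j + M := by simp [hwl]
    rw [hP, ← h4, List.getElem?_append_right (Nat.le_add_right _ _), Nat.add_sub_cancel_left,
      List.getElem?_eq_getElem h2, h4] at h3
    rw [Option.some.inj h3]
    congr 1
    ring

/-- The points of `S` vanishing on the blocks `[blockStart z g j, blockStart z g j + z j)`. -/
def zeroBlockSet [NeZero m] (S : Subshift m) (z : ℕ → ℕ) (g : ℕ) : Set (SymbolicSpace m) :=
  {x ∈ S.carrier | ∀ j, ∀ i < z j, x (blockStart z g j + i) = 0}

/-- The words of length `q` after the zero blocks are read as digits in base `b = #Σ^q`.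
Specification makes this map onto `[0, 1]`, and `hC` makes it Hölder of exponent `σ`, so the
dimension is at least `σ`. -/
lemma le_dimH_zeroBlockSet [NeZero m] (S : Subshift m) (hm : 2 ≤ m) (h0 : zeros m ∈ S.carrier) {M : ℕ}
    (hM : ∀ u ∈ S.language, ∀ v ∈ S.language, ∃ w ∈ S.words M, u ++ w ++ v ∈ S.language)
    {z : ℕ → ℕ} (hz : ∀ j, 1 ≤ z j) {q : ℕ} (hq : 1 ≤ q) (hb : 1 < (S.words q).ncard) {σ C : ℝ}
    (hσ : 0 < σ)
    (hC : ∀ K : ℕ, σ * Real.log m * blockStart z (2 * M + q) (K + 1) ≤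
      C + K * Real.log (S.words q).ncard) :
    ENNReal.ofReal σ ≤ dimH (S.zeroBlockSet z (2 * M + q)) := by
  classical
  set b := (S.words q).ncard with hbdef
  have hm0 : (0 : ℝ) < m := by positivity
  have hlog : 0 < Real.log m := Real.log_pos (by exact_mod_cast hm)
  have hb0 : (0 : ℝ) < b := by exact_mod_cast (zero_lt_one.trans hb)
  obtain ⟨e, he⟩ : ∃ e : List (Fin m) → Fin b, ∀ d, ∃ v ∈ S.words q, e v = d := by
    have : Finite (S.words q) := S.words_finite q
    let e₀ : S.words q ≃ Fin b := Finite.equivFinOfCardEq rfl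
    refine ⟨fun v => if h : v ∈ S.words q then e₀ ⟨v, h⟩ else ⟨0, by omega⟩, fun d =>
      ⟨e₀.symm d, (e₀.symm d).2, by simp⟩⟩
  let R : ℕ → ℕ := fun j => blockStart z (2 * M + q) j + z j + M
  let f : SymbolicSpace m → ℝ := fun x => Real.ofDigits fun j => e ((shift^[R j] x).firstLetters q)
  have hf : HolderOnWith (Real.exp C).toNNReal σ.toNNReal f (S.zeroBlockSet z (2 * M + q)) := by
    intro x _ y _
    rcases eq_or_ne x y with rfl | hxy
    · simp
    obtain ⟨N, hN, hd⟩ := exists_agree_of_ne hxy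
    have hex : ∃ j, N < R j + q :=
      ⟨N + 1, by have := le_blockStart hz (2 * M + q) (N + 1); simp only [R]; omega⟩
    -- `K` is the first digit whose word is not wholly inside the common prefix. The first `K`
    -- digits agree, while the first disagreement occurs before `blockStart (K + 1)`.
    set K := Nat.find hex with hK
    have hK1 : N < R K + q := Nat.find_spec hex
    have hagree : ∀ j < K, e ((shift^[R j] x).firstLetters q) = e ((shift^[R j] y).firstLetters q) := by
      intro j hj
      have h1 := Nat.find_min hex hj
      refine congrArg e (firstLetters_eq_iff.2 fun i hi => ?_)
      rw [shift_iterate_apply, shift_iterate_apply]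
      exact hN _ (by omega)
    have h2 := Real.abs_ofDigits_sub_ofDigits_le hagree
    have h3 : ((N + 1 : ℕ) : ℝ) ≤ blockStart z (2 * M + q) (K + 1) := by
      rw [blockStart_succ]
      simp only [R] at hK1
      exact_mod_cast (by omega)
    have h4 : ((b : ℝ) ^ K)⁻¹ = Real.exp (-(K * Real.log b)) := by
      rw [Real.exp_neg, Real.exp_nat_mul, Real.exp_log hb0]
    have h5 : dist x y ^ σ = Real.exp (-(σ * Real.log m * (N + 1 : ℕ))) := by
      rw [hd, ← Real.rpow_natCast, ← Real.rpow_mul (by positivity),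
        Real.rpow_def_of_pos (by positivity), Real.log_inv]
      congr 1; ring
    have h6 : dist (f x) (f y) ≤ Real.exp C * dist x y ^ σ := by
      rw [Real.dist_eq, h5, ← Real.exp_add]
      refine h2.trans ?_
      rw [h4]
      refine Real.exp_le_exp.2 ?_
      have := hC K
      have := mul_le_mul_of_nonneg_left h3 (by positivity : 0 ≤ σ * Real.log m)
      linarith
    rw [edist_dist, edist_dist, Real.coe_toNNReal σ hσ.le,
      ENNReal.ofReal_rpow_of_nonneg dist_nonneg hσ.le]
    refine (ENNReal.ofReal_le_ofReal h6).trans_eq ?_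
    rw [ENNReal.ofReal_mul (Real.exp_pos _).le]
    rfl
  have himg : Set.Icc (0 : ℝ) 1 ⊆ f '' (S.zeroBlockSet z (2 * M + q)) := by
    intro t ht
    obtain ⟨d, -, rfl⟩ := Real.ofDigits_SurjOn hb ht
    choose y hy hyd using fun j => he (d j)
    obtain ⟨x, hxS, hx⟩ := S.exists_mem_of_blocks hm h0 hM hz hq y hy
    refine ⟨x, ⟨hxS, fun j => (hx j).1⟩, ?_⟩
    simp only [f, R]
    congr 1
    funext j
    rw [(hx j).2, hyd]
  have h1 : (1 : ℝ≥0∞) ≤ dimH (S.zeroBlockSet z (2 * M + q)) / σ.toNNReal := by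
    calc (1 : ℝ≥0∞) = dimH (Set.Icc (0 : ℝ) 1) := by
          rw [Real.dimH_of_nonempty_interior (by simp)]; simp
      _ ≤ _ := (dimH_mono himg).trans (hf.dimH_image_le (Real.toNNReal_pos.2 hσ))
  rw [ENNReal.le_div_iff_mul_le (Or.inl (by simpa using hσ)) (Or.inl ENNReal.coe_ne_top),
    one_mul] at h1
  exact h1

lemma entropy_mul_le_log_ncard (S : Subshift m) {q : ℕ} (hq : 1 ≤ q) :
    q * S.entropy ≤ Real.log (S.words q).ncard := by
  have := S.subadditive_log_ncard_words.lim_le_div (n := q) ⟨0, by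
    rintro _ ⟨n, rfl⟩
    exact div_nonneg (Real.log_natCast_nonneg _) (Nat.cast_nonneg _)⟩ (by omega)
  rw [le_div_iff₀ (by exact_mod_cast hq)] at this
  rw [mul_comm]
  exact this

lemma one_lt_ncard_words (S : Subshift m) (h : 0 < S.entropy) {q : ℕ} (hq : 1 ≤ q) :
    1 < (S.words q).ncard := by
  have h1 := S.entropy_mul_le_log_ncard hq
  have h2 : 0 < q * S.entropy := mul_pos (by exact_mod_cast hq) h
  by_contra! hle
  have : Real.log (S.words q).ncard ≤ 0 :=
    Real.log_nonpos (Nat.cast_nonneg _) (by exact_mod_cast hle)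
  linarith

/-- Lower bound for the dimension of a set of points with prescribed zero blocks, in terms of the length
occupied by the first `K` blocks. -/
lemma le_dimH_zeroBlockSet_of_entropy [NeZero m] (S : Subshift m) (hm : 2 ≤ m) (h0 : zeros m ∈ S.carrier)
    (hent : 0 < S.entropy) {M : ℕ}
    (hM : ∀ u ∈ S.language, ∀ v ∈ S.language, ∃ w ∈ S.words M, u ++ w ++ v ∈ S.language)
    {z : ℕ → ℕ} (hz : ∀ j, 1 ≤ z j) {q : ℕ} (hq : 1 ≤ q) {σ D C : ℝ} (hσ : 0 < σ)
    (hD : σ * Real.log m * D ≤ q * S.entropy)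
    (hC : ∀ K : ℕ, (blockStart z (2 * M + q) (K + 1) : ℝ) ≤ D * K + C) :
    ENNReal.ofReal σ ≤ dimH (S.zeroBlockSet z (2 * M + q)) := by
  have hlog : 0 < Real.log m := Real.log_pos (by exact_mod_cast hm)
  refine S.le_dimH_zeroBlockSet hm h0 hM hz hq (S.one_lt_ncard_words hent hq) hσ
    (C := σ * Real.log m * C) fun K => ?_
  have h1 := mul_le_mul_of_nonneg_left (hC K) (by positivity : 0 ≤ σ * Real.log m)
  have h2 := mul_le_mul_of_nonneg_right (hD.trans (S.entropy_mul_le_log_ncard hq)) (Nat.cast_nonneg K)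
  linarith

/-- Long free words make the cost of the connecting words negligible. -/
lemma exists_block_length {A B : ℝ} (h : A < B) (c : ℝ) : ∃ q : ℕ, 1 ≤ q ∧ A * (q + c) < q * B := by
  obtain ⟨q, hq⟩ := exists_nat_gt (A * c / (B - A))
  rw [div_lt_iff₀ (by linarith)] at hq
  refine ⟨q + 1, by omega, ?_⟩
  push_cast
  nlinarith

lemma le_dimH_carrier [NeZero m] (S : Subshift m) (hm : 2 ≤ m) (hspec : S.HasSpecification)
    (hent : 0 < S.entropy) (h0 : zeros m ∈ S.carrier) :
    ENNReal.ofReal (S.entropy / Real.log m) ≤ dimH S.carrier := by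
  obtain ⟨M, hM⟩ := hspec
  have hlog : 0 < Real.log m := Real.log_pos (by exact_mod_cast hm)
  refine le_of_forall_lt fun r hr => ?_
  obtain ⟨s, hs1, hs2⟩ := ENNReal.lt_iff_exists_nnreal_btwn.1 hr
  refine lt_of_lt_of_le hs1 ?_
  rw [← ENNReal.ofReal_coe_nnreal] at hs2 ⊢
  have hs := (ENNReal.ofReal_lt_ofReal_iff (by positivity)).1 hs2
  have hs0 : (0 : ℝ) < s := by
    rw [← ENNReal.ofReal_coe_nnreal] at hs1
    exact ENNReal.ofReal_pos.1 (zero_le.trans_lt hs1)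
  rw [lt_div_iff₀ hlog] at hs
  obtain ⟨q, hq, hqs⟩ := exists_block_length hs (2 * M + 1)
  refine (S.le_dimH_zeroBlockSet_of_entropy hm h0 hent hM (z := fun _ => 1) (fun _ => le_rfl) hq hs0
    hqs.le (C := q + (2 * M + 1)) fun K => ?_).trans (dimH_mono fun x hx => hx.1)
  simp only [blockStart, Finset.sum_const, Finset.card_range, smul_eq_mul]
  push_cast
  linarith

end Subshift

/-! ### The optimal layout of long zero blocks. -/

/-- Sparse zero blocks: `J t` counts the ordinary blocks of length `Q` before the long block number `t`,
whose length is `L t`; the long block reaches the proportion `a` of the start of the next one. -/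
lemma exists_sparse_layout {a ε : ℝ} (ha0 : 0 < a) (ha1 : a < 1) (hε : 0 < ε) (Q : ℕ) :
    ∃ J L : ℕ → ℕ, Monotone J ∧ (∀ t, t < J t) ∧
      (∀ t, a * (Q * J (t + 1) + ∑ i ∈ Finset.range (t + 1), (L i : ℝ)) ≤ L t) ∧
      ∃ C, ∀ K, ∃ T, K + 1 ≤ J T ∧ Q * (K + 1 : ℝ) + ∑ i ∈ Finset.range T, (L i : ℝ) ≤
        (Q * ((1 + a) / (1 - a)) ^ 2 + ε) * K + C := by
  have ha' : 0 < 1 - a := by linarith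
  set s := 1 / (1 - a) with hs
  have hs1 : 1 < s := by rw [hs, lt_div_iff₀ ha']; linarith
  set κ := a / (1 - a) with hκ
  have hκ0 : 0 < κ := by positivity
  have hκs : 1 + κ = s := by rw [hs, hκ]; field_simp; ring
  -- With `J t ≈ r ^ t`, the recursion `A (t + 1) ≈ s * A t + κ Q r ^ (t + 1)` gives `A (t + 1) ≈ κ
  -- Q r ^ 2 / (r - s) * r ^ t`. The factor `r ^ 2 / (r - s)` is least at `r = 2 s`, with value `4
  -- s`, and `1 + 4 κ s = ((1 + a) / (1 - a)) ^ 2`.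
  let J : ℕ → ℕ := fun t => ⌈(2 * s) ^ t⌉₊
  let A : ℕ → ℕ := fun t => Nat.rec (motive := fun _ => ℕ) 0 (fun t (A : ℕ) => A + ⌈κ * (Q * J (t + 1) + (A : ℝ))⌉₊) t
  let L : ℕ → ℕ := fun t => ⌈κ * (Q * J (t + 1) + (A t : ℝ))⌉₊
  have hAs : ∀ t, A (t + 1) = A t + L t := fun t => rfl
  have hsum : ∀ t, ∑ i ∈ Finset.range t, (L i : ℝ) = A t := fun t => by
    induction t with
    | zero => simp [A]
    | succ t ih => rw [Finset.sum_range_succ, ih, hAs]; push_cast; rfl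
  have hJle : ∀ t, (2 * s) ^ t ≤ (J t : ℝ) := fun t => Nat.le_ceil _
  have hJlt : ∀ t, (J t : ℝ) < (2 * s) ^ t + 1 := fun t => Nat.ceil_lt_add_one (by positivity)
  have hJmono : Monotone J := fun t t' h =>
    Nat.ceil_mono (pow_le_pow_right₀ (by linarith) h)
  have hJid : ∀ t, t < J t := fun t => by
    have h1 : (t : ℝ) < 2 ^ t := by exact_mod_cast Nat.lt_two_pow_self
    have h2 : (2 : ℝ) ^ t ≤ (2 * s) ^ t := pow_le_pow_left₀ (by norm_num) (by linarith) t
    exact_mod_cast h1.trans_le (h2.trans (hJle t))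
  -- `D` absorbs the rounding errors: each step of the recursion adds at most `κ * Q + 1 = D * κ`.
  set D := (κ * Q + 1) / κ with hD
  have hD0 : 0 < D := by positivity
  have hDκ : D * κ = κ * Q + 1 := by rw [hD]; field_simp
  have hA : ∀ t, (A t : ℝ) ≤ 2 * κ * Q * (2 * s) ^ t + D * s ^ t - D := by
    intro t
    induction t with
    | zero => simp [A]; positivity
    | succ t ih =>
      have h1 : (L t : ℝ) < κ * (Q * J (t + 1) + A t) + 1 := Nat.ceil_lt_add_one (by positivity)
      have h2 : κ * (Q * J (t + 1)) ≤ κ * (Q * ((2 * s) ^ (t + 1) + 1)) := by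
        have := (hJlt (t + 1)).le
        gcongr
      have h3 := mul_le_mul_of_nonneg_left ih (by linarith : 0 ≤ s)
      have h4 : (A (t + 1) : ℝ) = A t + L t := by rw [hAs]; push_cast; rfl
      have h5 : s * A t = A t + κ * A t := by rw [← hκs]; ring
      have h6 : s * (2 * κ * Q * (2 * s) ^ t + D * s ^ t - D) =
        κ * Q * (2 * s) ^ (t + 1) + D * s ^ (t + 1) - D - D * κ := by
        rw [pow_succ, pow_succ]
        linear_combination D * hκs
      have h7 : 2 * κ * Q * (2 * s) ^ (t + 1) =
        κ * Q * (2 * s) ^ (t + 1) + κ * (Q * (2 * s) ^ (t + 1)) := by ring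
      linarith
  obtain ⟨T₀, hT₀⟩ := exists_pow_lt_of_lt_one (show 0 < ε / (2 * s * D) by positivity)
    (show (1 / 2 : ℝ) < 1 by norm_num)
  rw [lt_div_iff₀ (by positivity)] at hT₀
  -- Since `s < 2 s`, the error term is eventually below `ε * (2 * s) ^ t`; the finitely many
  -- earlier `t` go into a constant.
  have hDs : ∀ t, D * s ^ (t + 1) ≤ ε * (2 * s) ^ t + D * s ^ T₀ := by
    intro t
    rcases le_total (t + 1) T₀ with h | h
    · have h1 : s ^ (t + 1) ≤ s ^ T₀ := pow_le_pow_right₀ hs1.le h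
      have h2 := mul_le_mul_of_nonneg_left h1 hD0.le
      have h3 : 0 ≤ ε * (2 * s) ^ t := by positivity
      linarith
    · have h1 : (1 / 2 : ℝ) ^ (t + 1) ≤ (1 / 2) ^ T₀ :=
        pow_le_pow_of_le_one (by norm_num) (by norm_num) h
      have h2 : s ^ (t + 1) = (1 / 2) ^ (t + 1) * (2 * s) * (2 * s) ^ t := by
        rw [mul_assoc, ← pow_succ', ← mul_pow]
        congr 1; ring
      have h3 : (1 / 2 : ℝ) ^ (t + 1) * (2 * s * D) ≤ ε :=
        (mul_le_mul_of_nonneg_right h1 (by positivity)).trans hT₀.le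
      have h4 : 0 ≤ D * s ^ T₀ := by positivity
      have h5 := mul_le_mul_of_nonneg_right h3 (by positivity : 0 ≤ (2 * s) ^ t)
      rw [h2]
      linarith
  have hratio : ((1 + a) / (1 - a)) ^ 2 = 1 + 2 * κ * (2 * s) := by
    rw [hκ, hs]; field_simp; ring
  refine ⟨J, L, hJmono, hJid, fun t => ?_, Q + D * s ^ T₀, fun K => ?_⟩
  · rw [hsum, hAs]
    push_cast
    have h1 : κ * (Q * J (t + 1) + A t) ≤ L t := Nat.le_ceil _
    rw [hκ, div_mul_eq_mul_div, div_le_iff₀ ha'] at h1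
    linarith
  · have hex : ∃ T, K + 1 ≤ J T := ⟨K + 1, (hJid _).le⟩
    classical
    refine ⟨Nat.find hex, Nat.find_spec hex, ?_⟩
    rw [hsum, hratio]
    rcases hT : Nat.find hex with _ | t
    · have h1 : (0 : ℝ) ≤ (Q * (1 + 2 * κ * (2 * s)) + ε) * K - Q * K := by
        have : (Q * (1 + 2 * κ * (2 * s)) + ε) * K - Q * K =
          (Q * (2 * κ * (2 * s)) + ε) * K := by ring
        rw [this]; positivity
      have h2 : 0 ≤ D * s ^ T₀ := by positivity
      have h3 : A 0 = 0 := rfl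
      rw [h3, Nat.cast_zero]
      linarith
    · have h1 : J t ≤ K := by
        have := Nat.find_min hex (m := t) (by omega)
        omega
      have h2 : (2 * s) ^ t ≤ (K : ℝ) := (hJle t).trans (by exact_mod_cast h1)
      have h3 := hA (t + 1)
      have h4 := hDs t
      rw [pow_succ (2 * s)] at h3
      have h5 := mul_le_mul_of_nonneg_left h2 (by positivity : 0 ≤ 2 * κ * Q * (2 * s) + ε)
      linarith

/-! ### Lower bound for the run sets and conclusion. -/

namespace Subshift
open SymbolicSpace
variable {m : ℕ} [NeZero m]

/-- For `N` between the starts of the long blocks `J t` and `J (t + 1)`, the block `J t` is already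
counted in `L_N`, and its length is at least `a` times the later start. -/
lemma zeroBlockSet_subset_liminfZeroRunSet (S : Subshift m) {z : ℕ → ℕ} {g : ℕ} {a : ℝ} (ha : 0 ≤ a)
    (hz : ∀ j, 1 ≤ z j) {J : ℕ → ℕ} (hJ : ∀ t, t < J t)
    (h : ∀ t, a * blockStart z g (J (t + 1)) ≤ z (J t)) :
    S.zeroBlockSet z g ⊆ S.liminfZeroRunSet a := by
  rintro x ⟨hxS, hx⟩
  refine ⟨hxS, le_liminf_of_le (by isBoundedDefault) ?_⟩
  filter_upwards [eventually_ge_atTop (blockStart z g (J 0)), eventually_gt_atTop 0] with N hN hN0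
  have hex : ∃ t, N < blockStart z g (J t) :=
    ⟨N, (hJ N).trans_le (le_blockStart hz g _)⟩
  classical
  have hs := Nat.find_spec hex
  obtain ⟨t, ht⟩ : ∃ t, Nat.find hex = t + 1 :=
    Nat.exists_eq_succ_of_ne_zero fun h0 => by rw [h0] at hs; omega
  have h1 : blockStart z g (J t) ≤ N := not_lt.1 (Nat.find_min hex (by omega))
  rw [ht] at hs
  have h2 : 1 ≤ blockStart z g (J t) := by
    have := hJ t; have := le_blockStart hz g (J t); omega
  have h3 := le_maxZeroRun h2 h1 (hx (J t))
  have h0 : (N : ℝ≥0∞) ≠ 0 := by exact_mod_cast hN0.ne'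
  rw [ENNReal.le_div_iff_mul_le (Or.inl h0) (Or.inl (ENNReal.natCast_ne_top N))]
  calc ENNReal.ofReal a * N = ENNReal.ofReal (a * N) := by rw [ENNReal.ofReal_mul ha]; simp
    _ ≤ ENNReal.ofReal (z (J t) : ℝ) := by
        refine ENNReal.ofReal_le_ofReal ((mul_le_mul_of_nonneg_left ?_ ha).trans (h t))
        exact_mod_cast hs.le
    _ = ((z (J t) : ℕ∞) : ℝ≥0∞) := by simp
    _ ≤ _ := by exact_mod_cast h3

lemma le_dimH_liminfZeroRunSet (S : Subshift m) (hm : 2 ≤ m) (hspec : S.HasSpecification)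
    (hent : 0 < S.entropy) (h0 : zeros m ∈ S.carrier) {a : ℝ} (ha0 : 0 < a) (ha1 : a < 1) :
    ENNReal.ofReal (((1 - a) / (1 + a)) ^ 2 * (S.entropy / Real.log m)) ≤
      dimH (S.liminfZeroRunSet a) := by
  obtain ⟨M, hM⟩ := hspec
  have hlog : 0 < Real.log m := Real.log_pos (by exact_mod_cast hm)
  refine le_of_forall_lt fun r hr => ?_
  obtain ⟨s, hs1, hs2⟩ := ENNReal.lt_iff_exists_nnreal_btwn.1 hr
  refine lt_of_lt_of_le hs1 ?_
  rw [← ENNReal.ofReal_coe_nnreal] at hs2 ⊢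
  have hs0 : (0 : ℝ) < s := by
    rw [← ENNReal.ofReal_coe_nnreal] at hs1
    exact ENNReal.ofReal_pos.1 (zero_le.trans_lt hs1)
  have hs := (ENNReal.ofReal_lt_ofReal_iff_of_nonneg hs0.le).1 hs2
  have ha' : 0 < 1 - a := by linarith
  rw [← mul_div_assoc, lt_div_iff₀ hlog] at hs
  have hs' : s * Real.log m * ((1 + a) / (1 - a)) ^ 2 < S.entropy := by
    have h1 : 0 < ((1 + a) / (1 - a)) ^ 2 := by positivity
    have h2 := mul_lt_mul_of_pos_right hs h1
    have h3 : ((1 - a) / (1 + a)) ^ 2 * S.entropy * ((1 + a) / (1 - a)) ^ 2 = S.entropy := by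
      have : 1 + a ≠ 0 := by linarith
      field_simp
    linarith
  obtain ⟨q, hq, hqs⟩ := exists_block_length hs' (2 * M + 1)
  obtain ⟨ε, hε0, hε⟩ : ∃ ε > 0, s * Real.log m *
      ((2 * M + q + 1 : ℕ) * ((1 + a) / (1 - a)) ^ 2 + ε) ≤ q * S.entropy := by
    refine ⟨(q * S.entropy - s * Real.log m * ((1 + a) / (1 - a)) ^ 2 * (q + (2 * M + 1))) /
      (s * Real.log m), div_pos (by linarith) (by positivity), le_of_eq ?_⟩
    push_cast
    field_simp
    ring
  obtain ⟨J, L, hJmono, hJid, hJL, C, hC⟩ := exists_sparse_layout ha0 ha1 hε0 (2 * M + q + 1)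
  -- Every block has one zero, so that it is a nonempty word, and block `J t` gets `L t` more. The
  -- range `j + 1` catches every relevant `t`, because `t < J t`.
  let z : ℕ → ℕ := fun j => 1 + ∑ t ∈ Finset.range (j + 1), if J t = j then L t else 0
  have hz1 : ∀ j, 1 ≤ z j := fun j => Nat.le_add_right _ _
  have hzL : ∀ t, L t ≤ z (J t) := fun t => by
    refine le_trans ?_ (Nat.le_add_left _ _)
    refine le_trans (le_of_eq ?_) (Finset.single_le_sum
      (f := fun t' => if J t' = J t then L t' else 0) (fun _ _ => Nat.zero_le _)
      (Finset.mem_range.2 ((hJid t).trans (Nat.lt_succ_self _))))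
    simp
  have hzsum : ∀ K T, K ≤ J T → (blockStart z (2 * M + q) K : ℝ) ≤
      (2 * M + q + 1 : ℕ) * K + ∑ i ∈ Finset.range T, (L i : ℝ) := by
    intro K T hKT
    have h1 : ∀ j < K, z j ≤ 1 + ∑ t ∈ Finset.range T, if J t = j then L t else 0 := by
      intro j hj
      refine Nat.add_le_add_left (Finset.sum_le_sum_of_ne_zero fun t _ ht => ?_) 1
      have h2 : J t = j := by
        by_contra hne
        exact ht (if_neg hne)
      exact Finset.mem_range.2 (hJmono.reflect_lt (by omega))
    have h2 : blockStart z (2 * M + q) K ≤ (2 * M + q + 1) * K + ∑ i ∈ Finset.range T, L i := by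
      calc blockStart z (2 * M + q) K
          ≤ ∑ j ∈ Finset.range K, ((2 * M + q + 1) + ∑ t ∈ Finset.range T, if J t = j then L t else 0) :=
            Finset.sum_le_sum fun j hj => by have := h1 j (Finset.mem_range.1 hj); omega
        _ = (2 * M + q + 1) * K + ∑ t ∈ Finset.range T, ∑ j ∈ Finset.range K,
              (if J t = j then L t else 0) := by
            rw [Finset.sum_add_distrib, Finset.sum_comm]
            simp [mul_comm]
        _ ≤ _ := by
            refine Nat.add_le_add_left (Finset.sum_le_sum fun t _ => ?_) _
            rw [Finset.sum_ite_eq]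
            split_ifs <;> simp
    exact_mod_cast h2
  refine (S.le_dimH_zeroBlockSet_of_entropy hm h0 hent hM hz1 hq hs0 hε (C := C) fun K => ?_).trans
    (dimH_mono (S.zeroBlockSet_subset_liminfZeroRunSet ha0.le hz1 hJid fun t => ?_))
  · obtain ⟨T, hT, hle⟩ := hC K
    refine (hzsum _ T hT).trans ?_
    push_cast at hle ⊢
    exact hle
  · have h1 := mul_le_mul_of_nonneg_left (hzsum (J (t + 1)) (t + 1) le_rfl) ha0.le
    have h2 : (L t : ℝ) ≤ z (J t) := by exact_mod_cast hzL t
    exact h1.trans ((hJL t).trans h2)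

lemma dimH_carrier (S : Subshift m) (hm : 2 ≤ m) (hspec : S.HasSpecification)
    (hent : 0 < S.entropy) (h0 : zeros m ∈ S.carrier) :
    dimH S.carrier = ENNReal.ofReal (S.entropy / Real.log m) :=
  le_antisymm (S.dimH_carrier_le hm hent.le) (S.le_dimH_carrier hm hspec hent h0)

end Subshift

theorem corollary1p6 {m : ℕ} [NeZero m] (hm : 2 ≤ m) (S : Subshift m)
    (hspec : S.HasSpecification) (hent : 0 < S.entropy)
    (hzero : SymbolicSpace.zeros m ∈ S.carrier) :
    (∀ a : ℝ, 1 < a →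
      S.liminfZeroRunSet a =
        ⋃ n : ℕ, {x ∈ S.carrier | SymbolicSpace.shift^[n] x = SymbolicSpace.zeros m}) ∧
    (∀ a : ℝ, 0 ≤ a → a ≤ 1 →
      dimH (S.liminfZeroRunSet a) =
        ENNReal.ofReal (((1 - a) / (1 + a)) ^ 2) * dimH S.carrier) := by
  refine ⟨fun a ha => S.liminfZeroRunSet_of_one_lt ha, fun a ha0 ha1 => ?_⟩
  rcases ha0.eq_or_lt with rfl | ha0
  -- At `a = 0` the condition is void and the factor is `1`.
  · have : S.liminfZeroRunSet 0 = S.carrier := by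
      ext x
      simp [Subshift.liminfZeroRunSet]
    rw [this]
    simp
  rw [S.dimH_carrier hm hspec hent hzero, ← ENNReal.ofReal_mul (by positivity)]
  refine le_antisymm (S.dimH_liminfZeroRunSet_le hm hent.le ha0 ha1) ?_
  rcases ha1.eq_or_lt with rfl | ha1
  · simp
  · exact S.le_dimH_liminfZeroRunSet hm hspec hent hzero ha0 ha1
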